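/- **Conventions.** All graphs are simple, connected and locally finite, and $\mathbb{R}_+=[0,\infty)$. A random rooted graph $(G,\rho)$ is identified with its law, a Borel probability measure on the space of rooted isomorphism classes of rooted graphs with the local metric $\mathrm{d}_{\mathrm{loc}}=1/(1+\alpha)$, where $\alpha$ is the supremum of the $r>0$ such that the balls of radius $r$ around the two roots are isomorphic as rooted graphs; $\Rightarrow$ denotes weak convergence of laws. A rooted conformal graph is a triple $(G,\omega,\rho)$ with $\omega:V(G)\to\mathbb{R}_+$; isomorphism classes of these carry the analogous local metric, in which, in addition, the isomorphism of the $r$-balls may change the weights by at most $1/r$. A random rooted (conformal) graph is unimodular if it satisfies the Mass-Transport Principle $\mathbb{E}\sum_{x\in V(G)}F(G,\omega,\rho,x)=\mathbb{E}\sum_{x\in V(G)}F(G,\omega,x,\rho)$ for all Borel functions $F\ge 0$ of doubly rooted (conformal) graphs ($\omega$ is omitted for graphs without weights). A conformal metric on $(G,\rho)$ is a unimodular random rooted conformal graph $(G',\omega,\rho')$ such that $(G',\rho')$ has the law of $(G,\rho)$. It is $L^q$-normalized if $(\mathbb{E}\,\omega(\rho')^q)^{1/q}=1$. An edge $\{u,v\}$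 has $\omega$-length $\tfrac12(\omega(u)+\omega(v))$, $\mathrm{dist}_\omega$ is the induced path metric, and $B_\omega(x,R)=\{y:\mathrm{dist}_\omega(x,y)\le R\}$. We write $\|\cdot\|_{L^\infty}$ for the essential supremum. The upper $L^q$ conformal growth exponent is $$\overline{\dim}^{\,q}_{\mathsf{cg}}(G,\rho)=\inf_\omega\ \limsup_{R\to\infty}\frac{\log\|\#B_\omega(\rho,R)\|_{L^\infty}}{\log R}\in[-\infty,\infty],$$ the infimum being over all $L^q$-normalized conformal metrics on $(G,\rho)$ (and $+\infty$ if there are none). $(G,\rho)$ has $(C,R,d)$-growth if it has an $L^d$-normalized conformal metric $\omega$ with $\|\#B_\omega(\rho,R)\|_{L^\infty}\le CR^d$. It has gauged $d$-dimensional growth if there is $C\ge1$ such that it has $(C,R,d)$-growth for all $R\ge1$. A sequence $\{(G_n,\rho_n)\}$ has uniform gauged $d$-dimensional growth if there is $C\ge 1$ such that every $(G_n,\rho_n)$ has $(C,R,d)$-growth for all $R\ge1$. **Theorem.** Let $d,q\ge1$ be real numbers, and let $\{(G_n,\rho_n)\}$ be a sequence of unimodular random rooted graphs with $\{(G_n,\rho_n)\}\Rightarrow(G,\rho)$.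 1. Suppose there are a function $h:\mathbb{R}_+\to\mathbb{R}_+$ with $h(R)\le R^{o(1)}$ as $R\to\infty$ and, for every $n$, an $L^q$-normalized conformal metric $\omega_n$ on $(G_n,\rho_n)$ such that $$\|\#B_{\omega_n}(\rho_n,R)\|_{L^\infty}\le R^d\,h(R)\qquad\text{for all } n \text{ and all } R\ge1.$$ Then $\overline{\dim}^{\,q}_{\mathsf{cg}}(G,\rho)\le d$. 2. If $\{(G_n,\rho_n)\}$ has uniform gauged $d$-dimensional growth, then $(G,\rho)$ has gauged $d$-dimensional growth. -/

import Mathlib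

open MeasureTheory Filter Topology
open scoped NNReal ENNReal

/-! ### Connected, locally finite, multiply rooted networks with vertex marks -/

/-- A connected, locally finite simple graph with a vertex marking `mark : V → Ξ` and `k`
distinguished vertices (roots).  Since such graphs are countable, vertex sets in `Type` suffice. -/
structure Network (Ξ : Type) (k : ℕ) where
  V : Type
  graph : SimpleGraph V
  connected : graph.Connected
  locallyFinite : ∀ v : V, (graph.neighborSet v).Finite
  mark : V → Ξ
  root : Fin k → V

namespace Network

variable {Ξ : Type} {k : ℕ}

/-- Isomorphism of networks: a graph isomorphism preserving marks and roots. -/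
def Iso (N M : Network Ξ k) : Prop :=
  ∃ φ : N.graph ≃g M.graph, (∀ v, M.mark (φ v) = N.mark v) ∧ ∀ i, φ (N.root i) = M.root i

theorem Iso.refl (N : Network Ξ k) : Iso N N := ⟨RelIso.refl _, fun _ => rfl, fun _ => rfl⟩

theorem Iso.symm {N M : Network Ξ k} : Iso N M → Iso M N := by
  rintro ⟨φ, h1, h2⟩
  refine ⟨φ.symm, fun v => ?_, fun i => ?_⟩
  · rw [← h1, RelIso.apply_symm_apply]
  · rw [← h2, RelIso.symm_apply_apply]

theorem Iso.trans {N M L : Network Ξ k} : Iso N M → Iso M L → Iso N L := by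
  rintro ⟨φ, h1, h2⟩ ⟨ψ, h3, h4⟩
  refine ⟨φ.trans ψ, fun v => ?_, fun i => ?_⟩
  · rw [RelIso.trans_apply, h3, h1]
  · rw [RelIso.trans_apply, h2, h4]

instance setoid (Ξ : Type) (k : ℕ) : Setoid (Network Ξ k) :=
  ⟨Iso, Iso.refl, Iso.symm, Iso.trans⟩

/-- The closed ball of radius `r` around the root in the unweighted graph metric (the union of
the balls around the roots, if there are several). -/
def ball (N : Network Ξ k) (r : ℝ) : Set N.V :=
  {v | ∃ i, (N.graph.dist (N.root i) v : ℝ) ≤ r}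

/-- The balls of radius `r` (as induced subgraphs) are isomorphic by an isomorphism that preserves
the roots and changes the marks by at most `1 / r`. -/
def Agree [PseudoMetricSpace Ξ] (r : ℝ) (N M : Network Ξ k) : Prop :=
  ∃ φ : N.graph.induce (N.ball r) ≃g M.graph.induce (M.ball r),
    (∀ (i : Fin k) (h : N.root i ∈ N.ball r), (φ ⟨N.root i, h⟩ : M.V) = M.root i) ∧
    ∀ v, dist (M.mark (φ v)) (N.mark v) ≤ 1 / r

/-- `α = sup {r > 0 : the r-balls agree}`, a number in `[0, ∞]`. -/
noncomputable def agreeRadius [PseudoMetricSpace Ξ] (N M : Network Ξ k) : ℝ≥0∞ :=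
  ⨆ (r : ℝ) (_ : 0 < r ∧ Agree r N M), ENNReal.ofReal r

/-- The local distance `1 / (1 + α)`. -/
noncomputable def locDist [PseudoMetricSpace Ξ] (N M : Network Ξ k) : ℝ :=
  ((1 + agreeRadius N M)⁻¹).toReal

theorem root_mem_ball (N : Network Ξ k) {r : ℝ} (hr : 0 ≤ r) (i : Fin k) : N.root i ∈ N.ball r :=
  ⟨i, by simpa using hr⟩

theorem dist_map_le {N M : Network Ξ k} {r s : ℝ} (hr : 0 ≤ r) (hrs : r ≤ s)
    (φ : N.graph.induce (N.ball s) ≃g M.graph.induce (M.ball s))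
    (hφ : ∀ (i : Fin k) (h : N.root i ∈ N.ball s), (φ ⟨N.root i, h⟩ : M.V) = M.root i)
    (v : N.ball s) (hv : (v : N.V) ∈ N.ball r) : (φ v : M.V) ∈ M.ball r := by
  classical
  obtain ⟨i, hi⟩ := hv
  refine ⟨i, ?_⟩
  obtain ⟨p, hp⟩ := N.connected.exists_walk_length_eq_dist (N.root i) v
  have hsupp : ∀ x ∈ p.support, x ∈ N.ball s := fun x hx => by
    refine ⟨i, le_trans ?_ (hi.trans hrs)⟩
    rw [← hp]
    exact_mod_cast (SimpleGraph.dist_le (p.takeUntil x hx)).trans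
      (p.length_takeUntil_le_length hx)
  let q := ((p.induce (N.ball s) hsupp).map φ.toHom).map
    (SimpleGraph.Embedding.induce (G := M.graph) (M.ball s)).toHom
  have hq : q.length = p.length := by
    rw [SimpleGraph.Walk.length_map, SimpleGraph.Walk.length_map, ← SimpleGraph.Walk.length_map
      (SimpleGraph.Embedding.induce (G := N.graph) (N.ball s)).toHom, SimpleGraph.Walk.map_induce]
    rfl
  have h := SimpleGraph.dist_le q
  rw [hq, hp] at h
  have e := hφ i (root_mem_ball N (hr.trans hrs) i)
  rw [← e]
  exact le_trans (by exact_mod_cast h) hi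

section metric

variable [PseudoMetricSpace Ξ]

theorem Agree.symm {r : ℝ} (hr : 0 ≤ r) {N M : Network Ξ k} (h : Agree r N M) : Agree r M N := by
  obtain ⟨φ, h1, h2⟩ := h
  refine ⟨φ.symm, fun i hi => ?_, fun v => ?_⟩
  · have : φ ⟨N.root i, root_mem_ball N hr i⟩ = ⟨M.root i, hi⟩ := Subtype.ext (h1 i _)
    rw [← this, RelIso.symm_apply_apply]
  · have := h2 (φ.symm v)
    rwa [RelIso.apply_symm_apply, dist_comm] at this

theorem Agree.comp {r s t : ℝ} (hr : 0 < r) (hs : r ≤ s) (ht : r ≤ t)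
    (hrst : 1 / s + 1 / t ≤ 1 / r) {N M L : Network Ξ k}
    (h : Agree s N M) (h' : Agree t M L) : Agree r N L := by
  have restr : ∀ {u : ℝ} {A B : Network Ξ k}, r ≤ u → Agree u A B →
      ∃ φ : A.graph.induce (A.ball r) ≃g B.graph.induce (B.ball r),
        (∀ (i : Fin k) (h : A.root i ∈ A.ball r), (φ ⟨A.root i, h⟩ : B.V) = B.root i) ∧
        ∀ v, dist (B.mark (φ v)) (A.mark v) ≤ 1 / u := by
    intro u A B hu hAB
    have hu0 : 0 ≤ u := hr.le.trans hu
    have hmono : ∀ C : Network Ξ k, C.ball r ⊆ C.ball u := fun C v ⟨i, hi⟩ => ⟨i, hi.trans hu⟩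
    obtain ⟨φ, h1, h2⟩ := hAB
    obtain ⟨ψ, hψ⟩ : ∃ ψ, ψ = φ.symm := ⟨_, rfl⟩
    have h1' : ∀ (i : Fin k) (h : B.root i ∈ B.ball u), (ψ ⟨B.root i, h⟩ : A.V) = A.root i := by
      intro i hi
      have : φ ⟨A.root i, root_mem_ball A hu0 i⟩ = ⟨B.root i, hi⟩ := Subtype.ext (h1 i _)
      rw [hψ, ← this, RelIso.symm_apply_apply]
    refine ⟨⟨⟨fun v => ⟨φ ⟨v, hmono A v.2⟩, dist_map_le hr.le hu φ h1 _ v.2⟩,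
      fun v => ⟨ψ ⟨v, hmono B v.2⟩, dist_map_le hr.le hu ψ h1' _ v.2⟩,
      fun v => ?_, fun v => ?_⟩, ?_⟩, fun i hi => h1 i _, fun v => h2 ⟨v, hmono A v.2⟩⟩
    · apply Subtype.ext
      simp [hψ]
    · apply Subtype.ext
      simp [hψ]
    · intro a b
      exact φ.map_rel_iff (a := ⟨a, hmono A a.2⟩) (b := ⟨b, hmono A b.2⟩)
  obtain ⟨φ, h1, h2⟩ := restr hs h
  obtain ⟨ψ, h3, h4⟩ := restr ht h'
  refine ⟨φ.trans ψ, fun i hi => ?_, fun v => ?_⟩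
  · have : φ ⟨N.root i, hi⟩ = ⟨M.root i, root_mem_ball M hr.le i⟩ := Subtype.ext (h1 i _)
    rw [RelIso.trans_apply, this, h3]
  · rw [RelIso.trans_apply]
    calc _ ≤ _ := dist_triangle _ (M.mark (φ v)) _
      _ ≤ 1 / t + 1 / s := add_le_add (h4 _) (h2 _)
      _ ≤ 1 / r := by linarith

theorem Iso.agree {N M : Network Ξ k} (h : Iso N M) {r : ℝ} (hr : 0 < r) : Agree r N M := by
  obtain ⟨φ, h1, h2⟩ := h
  have key : ∀ {A B : Network Ξ k} (φ : A.graph ≃g B.graph), (∀ i, φ (A.root i) = B.root i) →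
      ∀ v ∈ A.ball r, φ v ∈ B.ball r := by
    rintro A B φ h v ⟨i, hi⟩
    refine ⟨i, le_trans ?_ hi⟩
    obtain ⟨p, hp⟩ := A.connected.exists_walk_length_eq_dist (A.root i) v
    have := SimpleGraph.dist_le (p.map φ.toHom)
    rw [SimpleGraph.Walk.length_map, hp] at this
    rw [← h]
    exact_mod_cast this
  have h2' : ∀ i, φ.symm (M.root i) = N.root i := fun i => by
    rw [← h2, RelIso.symm_apply_apply]
  refine ⟨⟨⟨fun v => ⟨φ v, key φ h2 _ v.2⟩, fun v => ⟨φ.symm v, key φ.symm h2' _ v.2⟩,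
    fun v => ?_, fun v => ?_⟩, ?_⟩, fun i hi => h2 i, fun v => ?_⟩
  · simp
  · simp
  · intro a b
    exact φ.map_rel_iff (a := (a : N.V)) (b := b)
  · have := h1 v
    change dist (M.mark (φ v)) (N.mark v) ≤ 1 / r
    rw [this, dist_self]
    positivity

theorem locDist_nonneg (N M : Network Ξ k) : 0 ≤ locDist N M := ENNReal.toReal_nonneg

theorem locDist_le {N M : Network Ξ k} {r : ℝ} (hr : 0 < r) (h : Agree r N M) :
    locDist N M ≤ 1 / (1 + r) := by
  have h1 : ENNReal.ofReal r ≤ agreeRadius N M := le_iSup₂_of_le r ⟨hr, h⟩ le_rfl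
  have h2 : (1 + agreeRadius N M)⁻¹ ≤ ENNReal.ofReal (1 / (1 + r)) := by
    rw [one_div, ENNReal.ofReal_inv_of_pos (by linarith), ENNReal.ofReal_add zero_le_one hr.le,
      ENNReal.ofReal_one]
    exact ENNReal.inv_le_inv.2 (by gcongr)
  exact ENNReal.toReal_le_of_le_ofReal (by positivity) h2

theorem locDist_le_one (N M : Network Ξ k) : locDist N M ≤ 1 := by
  refine ENNReal.toReal_le_of_le_ofReal zero_le_one ?_
  rw [ENNReal.ofReal_one]
  exact ENNReal.inv_le_one.2 le_self_add

theorem exists_agree_of_locDist_lt {N M : Network Ξ k} {c : ℝ} (hc : c ≤ 1)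
    (h : locDist N M < c) : ∃ r, 0 < r ∧ Agree r N M ∧ 1 / (1 + r) < c := by
  have hc0 : 0 < c := (locDist_nonneg N M).trans_lt h
  have h1 : (1 + agreeRadius N M)⁻¹ < ENNReal.ofReal c := by
    rw [locDist] at h
    exact (ENNReal.lt_ofReal_iff_toReal_lt (by simp)).2 h
  have h2 : ENNReal.ofReal (1 / c - 1) < agreeRadius N M := by
    by_contra! hcon
    refine absurd h1 (not_lt.2 ?_)
    have : 1 + agreeRadius N M ≤ (ENNReal.ofReal c)⁻¹ := by
      calc 1 + agreeRadius N M ≤ ENNReal.ofReal 1 + ENNReal.ofReal (1 / c - 1) := by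
            rw [ENNReal.ofReal_one]; gcongr
        _ = (ENNReal.ofReal c)⁻¹ := by
            rw [← ENNReal.ofReal_add zero_le_one (by
              rw [sub_nonneg, le_div_iff₀ hc0]; linarith), ← ENNReal.ofReal_inv_of_pos hc0]
            congr 1
            rw [one_div]; ring
    rw [← inv_inv (ENNReal.ofReal c)]
    exact ENNReal.inv_le_inv.2 this
  rw [agreeRadius, lt_iSup_iff] at h2
  obtain ⟨r, h2⟩ := h2
  rw [lt_iSup_iff] at h2
  obtain ⟨⟨hr, ha⟩, h2⟩ := h2
  refine ⟨r, hr, ha, ?_⟩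
  have h3 : 1 / c - 1 < r := (ENNReal.ofReal_lt_ofReal_iff hr).1 h2
  rw [div_lt_iff₀ (by linarith)]
  have h4 : 1 / c < 1 + r := by linarith
  rw [div_lt_iff₀ hc0] at h4
  linarith

theorem locDist_eq_zero_of_iso {N M : Network Ξ k} (h : Iso N M) : locDist N M = 0 := by
  refine le_antisymm (le_of_forall_gt_imp_ge_of_dense fun c hc => ?_) (locDist_nonneg N M)
  refine (locDist_le (r := 1 / c) (by positivity) (h.agree (by positivity))).trans ?_
  rw [div_le_iff₀ (by positivity)]
  have : c * (1 / c) = 1 := mul_one_div_cancel hc.ne'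
  nlinarith

theorem locDist_comm (N M : Network Ξ k) : locDist N M = locDist M N := by
  have : ∀ r : ℝ, (0 < r ∧ Agree r N M) ↔ (0 < r ∧ Agree r M N) := fun r =>
    ⟨fun h => ⟨h.1, h.2.symm h.1.le⟩, fun h => ⟨h.1, h.2.symm h.1.le⟩⟩
  simp only [locDist, agreeRadius, this]

theorem locDist_triangle (N M L : Network Ξ k) :
    locDist N L ≤ locDist N M + locDist M L := by
  by_contra! hcon
  have hN := locDist_le_one N L
  have h0 := locDist_nonneg N M
  have h1 := locDist_nonneg M L
  obtain ⟨e, he⟩ : ∃ e, e = (locDist N L - (locDist N M + locDist M L)) / 2 := ⟨_, rfl⟩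
  obtain ⟨s, hs, hsa, hs'⟩ := exists_agree_of_locDist_lt (N := N) (M := M)
    (c := locDist N M + e) (by linarith) (by linarith)
  obtain ⟨t, ht, hta, ht'⟩ := exists_agree_of_locDist_lt (N := M) (M := L)
    (c := locDist M L + e) (by linarith) (by linarith)
  obtain ⟨a, ha⟩ : ∃ a, a = 1 / (1 + s) := ⟨_, rfl⟩
  obtain ⟨b, hb⟩ : ∃ b, b = 1 / (1 + t) := ⟨_, rfl⟩
  have ha0 : 0 < a := by rw [ha]; positivity
  have hb0 : 0 < b := by rw [hb]; positivity
  have hab : a + b < locDist N L := by rw [ha, hb]; linarith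
  have hs1 : s = 1 / a - 1 := by rw [ha]; field_simp; ring
  have ht1 : t = 1 / b - 1 := by rw [hb]; field_simp; ring
  have hab1 : 0 < 1 - a - b := by linarith
  have hr0 : 0 < 1 / (a + b) - 1 := by
    rw [sub_pos, lt_div_iff₀ (by positivity)]; linarith
  have hag : Agree (1 / (a + b) - 1) N L := by
    refine Agree.comp hr0 ?_ ?_ ?_ hsa hta
    · rw [hs1]; gcongr; linarith
    · rw [ht1]; gcongr; linarith
    · have e1 : 1 / s = a / (1 - a) := by
        rw [hs1]; have : (1 - a) ≠ 0 := by linarith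
        field_simp
      have e2 : 1 / t = b / (1 - b) := by
        rw [ht1]; have : (1 - b) ≠ 0 := by linarith
        field_simp
      have e3 : 1 / (1 / (a + b) - 1) = a / (1 - a - b) + b / (1 - a - b) := by
        have : (1 - (a + b)) ≠ 0 := by linarith
        have : (1 - a - b) ≠ 0 := by linarith
        rw [← add_div, div_sub_one (by positivity), one_div_div]
        congr 1
        ring
      rw [e1, e2, e3]
      exact add_le_add (div_le_div_of_nonneg_left ha0.le hab1 (by linarith))
        (div_le_div_of_nonneg_left hb0.le hab1 (by linarith))
  have := locDist_le hr0 hag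
  rw [add_sub_cancel, one_div_one_div] at this
  linarith

theorem locDist_congr {N M N' M' : Network Ξ k} (h : Iso N N') (h' : Iso M M') :
    locDist N M = locDist N' M' := by
  have e1 := locDist_eq_zero_of_iso h
  have e2 := locDist_eq_zero_of_iso h'
  have e1' := locDist_comm N N'
  have e2' := locDist_comm M M'
  have t1 := locDist_triangle N N' M
  have t2 := locDist_triangle N' M' M
  have t3 := locDist_triangle N' N M'
  have t4 := locDist_triangle N M M'
  apply le_antisymm <;> linarith

end metric

end Network

/-! ### Spaces of isomorphism classes -/

/-- The set of isomorphism classes of connected, locally finite, `k`-rooted networks. -/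
def NetworkClass (Ξ : Type) (k : ℕ) := Quotient (Network.setoid Ξ k)

namespace NetworkClass

variable {Ξ : Type} {k : ℕ}

/-- The isomorphism class of a network. -/
def mk (N : Network Ξ k) : NetworkClass Ξ k := Quotient.mk _ N

noncomputable instance [PseudoMetricSpace Ξ] : PseudoMetricSpace (NetworkClass Ξ k) where
  dist := Quotient.lift₂ Network.locDist fun _ _ _ _ h h' => Network.locDist_congr h h'
  dist_self := by
    rintro ⟨N⟩
    exact Network.locDist_eq_zero_of_iso (Network.Iso.refl N)
  dist_comm := by
    rintro ⟨N⟩ ⟨M⟩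
    exact Network.locDist_comm N M
  dist_triangle := by
    rintro ⟨N⟩ ⟨M⟩ ⟨L⟩
    exact Network.locDist_triangle N M L

noncomputable instance [PseudoMetricSpace Ξ] : MeasurableSpace (NetworkClass Ξ k) := borel _

instance [PseudoMetricSpace Ξ] : BorelSpace (NetworkClass Ξ k) := ⟨rfl⟩

end NetworkClass

/-- Rooted isomorphism classes of connected, locally finite rooted graphs (marks are trivial). -/
abbrev RootedGraph := NetworkClass Unit 1

/-- Isomorphism classes of rooted conformal graphs `(G, ω, ρ)`, `ω : V(G) → [0, ∞)`. -/
abbrev RootedConformalGraph := NetworkClass ℝ≥0 1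

/-! ### Unimodularity -/

namespace Network

variable {Ξ : Type} {k : ℕ}

/-- The same marked graph with the roots replaced. -/
def reroot {l : ℕ} (N : Network Ξ k) (ρ : Fin l → N.V) : Network Ξ l :=
  ⟨N.V, N.graph, N.connected, N.locallyFinite, N.mark, ρ⟩

/-- `∑_{x ∈ V(G)} F(G, ρ, x)`. -/
noncomputable def massOut (F : NetworkClass Ξ 2 → ℝ≥0∞) (N : Network Ξ 1) : ℝ≥0∞ :=
  ∑' x : N.V, F (NetworkClass.mk (N.reroot ![N.root 0, x]))

/-- `∑_{x ∈ V(G)} F(G, x, ρ)`. -/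
noncomputable def massIn (F : NetworkClass Ξ 2 → ℝ≥0∞) (N : Network Ξ 1) : ℝ≥0∞ :=
  ∑' x : N.V, F (NetworkClass.mk (N.reroot ![x, N.root 0]))

theorem massOut_congr (F : NetworkClass Ξ 2 → ℝ≥0∞) {N M : Network Ξ 1} (h : Iso N M) :
    massOut F N = massOut F M := by
  obtain ⟨φ, h1, h2⟩ := h
  refine Eq.trans (tsum_congr fun x => ?_) (Equiv.tsum_eq φ.toEquiv _)
  refine congrArg F (Quotient.sound ⟨φ, h1, fun i => ?_⟩)
  · fin_cases i
    · exact h2 0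
    · rfl

theorem massIn_congr (F : NetworkClass Ξ 2 → ℝ≥0∞) {N M : Network Ξ 1} (h : Iso N M) :
    massIn F N = massIn F M := by
  obtain ⟨φ, h1, h2⟩ := h
  refine Eq.trans (tsum_congr fun x => ?_) (Equiv.tsum_eq φ.toEquiv _)
  refine congrArg F (Quotient.sound ⟨φ, h1, fun i => ?_⟩)
  · fin_cases i
    · rfl
    · exact h2 0

end Network

/-- The Mass-Transport Principle for the law `P` of a random rooted network. -/
def Unimodular {Ξ : Type} [PseudoMetricSpace Ξ]
    (P : ProbabilityMeasure (NetworkClass Ξ 1)) : Prop :=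
  ∀ F : NetworkClass Ξ 2 → ℝ≥0∞, Measurable F →
    ∫⁻ g, Quotient.lift (Network.massOut F) (fun _ _ h => Network.massOut_congr F h) g
        ∂(P : Measure (NetworkClass Ξ 1)) =
      ∫⁻ g, Quotient.lift (Network.massIn F) (fun _ _ h => Network.massIn_congr F h) g
        ∂(P : Measure (NetworkClass Ξ 1))

/-! ### Conformal metrics -/

/-- The length `∑ (ω(v_j) + ω(v_{j+1})) / 2` of a path `v_0, v_1, …`. -/
noncomputable def walkLength {V : Type} {G : SimpleGraph V} (ω : V → ℝ≥0) {u v : V}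
    (p : G.Walk u v) : ℝ≥0 :=
  (p.darts.map fun e => (ω e.fst + ω e.snd) / 2).sum

/-- The path metric `dist_ω(u, v)`. -/
noncomputable def confDist {V : Type} (G : SimpleGraph V) (ω : V → ℝ≥0) (u v : V) : ℝ≥0 :=
  ⨅ p : G.Walk u v, walkLength ω p

/-- The closed ball `B_ω(x, R)`. -/
def confBall {V : Type} (G : SimpleGraph V) (ω : V → ℝ≥0) (x : V) (R : ℝ≥0) : Set V :=
  {y | confDist G ω x y ≤ R}

namespace Network

theorem confDist_map_le {V W : Type} {G : SimpleGraph V} {H : SimpleGraph W} {ω : V → ℝ≥0}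
    {ω' : W → ℝ≥0} (hG : G.Connected) (φ : G ≃g H) (h : ∀ v, ω' (φ v) = ω v) (u v : V) :
    confDist H ω' (φ u) (φ v) ≤ confDist G ω u v := by
  have : Nonempty (G.Walk u v) := hG u v
  refine le_ciInf fun p => ?_
  refine (ciInf_le (OrderBot.bddBelow _) (p.map φ.toHom)).trans (le_of_eq ?_)
  rw [walkLength, walkLength, SimpleGraph.Walk.darts_map, List.map_map]
  congr 2
  funext e
  have h1 := h e.fst
  have h2 := h e.snd
  change (ω' (φ e.fst) + ω' (φ e.snd)) / 2 = _
  rw [h1, h2]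

/-- `#B_ω(ρ, R)`, possibly infinite. -/
noncomputable def ballCard (R : ℝ≥0) (N : Network ℝ≥0 1) : ℕ∞ :=
  (confBall N.graph N.mark (N.root 0) R).encard

theorem ballCard_congr (R : ℝ≥0) {N M : Network ℝ≥0 1} (h : Iso N M) :
    ballCard R N = ballCard R M := by
  have key : ∀ {A B : Network ℝ≥0 1}, Iso A B → ballCard R A ≤ ballCard R B := by
    rintro A B ⟨φ, h1, h2⟩
    rw [ballCard, ballCard, ← φ.injective.encard_image]
    refine Set.encard_le_encard ?_
    rintro _ ⟨y, hy, rfl⟩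
    change confDist _ _ _ _ ≤ R
    rw [← h2]
    exact (confDist_map_le A.connected φ h1 _ _).trans hy
  exact le_antisymm (key h) (key h.symm)

theorem rootMark_congr {Ξ : Type} {N M : Network Ξ 1} (h : Iso N M) :
    N.mark (N.root 0) = M.mark (M.root 0) := by
  obtain ⟨φ, h1, h2⟩ := h
  rw [← h2, h1]

/-- Forget the marks. -/
def forget {Ξ : Type} {k : ℕ} (N : Network Ξ k) : Network Unit k :=
  ⟨N.V, N.graph, N.connected, N.locallyFinite, fun _ => (), N.root⟩

theorem forget_congr {Ξ : Type} {k : ℕ} {N M : Network Ξ k} (h : Iso N M) :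
    Iso N.forget M.forget := by
  obtain ⟨φ, _, h2⟩ := h
  exact ⟨φ, fun _ => rfl, h2⟩

end Network

namespace RootedConformalGraph

/-- The underlying rooted graph `(G, ρ)` of `(G, ω, ρ)`. -/
def toRootedGraph : RootedConformalGraph → RootedGraph :=
  Quotient.map Network.forget fun _ _ h => Network.forget_congr h

/-- `ω(ρ)`. -/
def rootWeight : RootedConformalGraph → ℝ≥0 :=
  Quotient.lift (fun N => N.mark (N.root 0)) fun _ _ h => Network.rootMark_congr h

/-- `#B_ω(ρ, R)`. -/
noncomputable def ballCard (R : ℝ≥0) : RootedConformalGraph → ℕ∞ :=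
  Quotient.lift (Network.ballCard R) fun _ _ h => Network.ballCard_congr R h

end RootedConformalGraph

/-- `Q` is the law of a conformal metric on the random rooted graph with law `P`: a unimodular
random rooted conformal graph whose underlying random rooted graph has law `P`. -/
def IsConformalMetricOn (Q : ProbabilityMeasure RootedConformalGraph)
    (P : ProbabilityMeasure RootedGraph) : Prop :=
  Unimodular Q ∧
    (Q : Measure RootedConformalGraph).map RootedConformalGraph.toRootedGraph =
      (P : Measure RootedGraph)

/-- `‖ω‖_{L^q} = (𝔼 ω(ρ)^q)^{1/q}`. -/
noncomputable def weightNorm (q : ℝ) (Q : ProbabilityMeasure RootedConformalGraph) : ℝ≥0∞ :=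
  (∫⁻ g, (RootedConformalGraph.rootWeight g : ℝ≥0∞) ^ q
    ∂(Q : Measure RootedConformalGraph)) ^ (1 / q)

/-- `ω` is `L^q`-normalized. -/
def IsNormalized (q : ℝ) (Q : ProbabilityMeasure RootedConformalGraph) : Prop :=
  weightNorm q Q = 1

/-- `‖#B_ω(ρ, R)‖_{L^∞}`. -/
noncomputable def growth (Q : ProbabilityMeasure RootedConformalGraph) (R : ℝ≥0) : ℝ≥0∞ :=
  essSup (fun g => ((RootedConformalGraph.ballCard R g : ℕ∞) : ℝ≥0∞))
    (Q : Measure RootedConformalGraph)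

/-- The upper `L^q` conformal growth exponent, with values in `[-∞, ∞]`. -/
noncomputable def upperGrowthExponent (q : ℝ) (P : ProbabilityMeasure RootedGraph) : EReal :=
  ⨅ (Q : ProbabilityMeasure RootedConformalGraph)
    (_ : IsConformalMetricOn Q P ∧ IsNormalized q Q),
    limsup (fun R : ℝ≥0 => ENNReal.log (growth Q R) / ((Real.log (R : ℝ) : ℝ) : EReal)) atTop

/-- `(C, R, d)`-growth. -/
def HasGrowth (C R : ℝ≥0) (d : ℝ) (P : ProbabilityMeasure RootedGraph) : Prop :=
  ∃ Q : ProbabilityMeasure RootedConformalGraph,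
    IsConformalMetricOn Q P ∧ IsNormalized d Q ∧ growth Q R ≤ (C : ℝ≥0∞) * (R : ℝ≥0∞) ^ d

/-- Gauged `d`-dimensional conformal growth.  The scales are `R ≥ 1`: a ball contains its centre,
so `(C, R, d)`-growth fails whenever `C * R ^ d < 1`. -/
def HasGaugedGrowth (d : ℝ) (P : ProbabilityMeasure RootedGraph) : Prop :=
  ∃ C : ℝ≥0, 1 ≤ C ∧ ∀ R : ℝ≥0, 1 ≤ R → HasGrowth C R d P

/-- Uniform gauged `d`-dimensional conformal growth of a sequence. -/
def HasUniformGaugedGrowth (d : ℝ) (P : ℕ → ProbabilityMeasure RootedGraph) : Prop :=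
  ∃ C : ℝ≥0, 1 ≤ C ∧ ∀ R : ℝ≥0, 1 ≤ R → ∀ n, HasGrowth C R d (P n)

/-- `h(R) ≤ R^{o(1)}` as `R → ∞`. -/
def IsSubpolynomial (h : ℝ≥0 → ℝ≥0) : Prop :=
  ∃ ε : ℝ≥0 → ℝ, Tendsto ε atTop (𝓝 0) ∧ ∀ᶠ R in atTop, h R ≤ R ^ ε R

/-! ### Local isomorphisms of networks -/

namespace Network

variable {Ξ : Type} {k : ℕ}

/-! The laws of the rooted conformal graphs $(G_n,\omega_n,\rho_n)$ live on one space, and the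
conformal metric on the limit is a modified weak limit of them. Three points need an argument.

Tightness. Networks with bounded ball sizes and with marks in prescribed compact sets form a compact
set (`isCompact_image_boundedBalls`). Ball sizes of $(G_n,\rho_n)$ are tight because the graphs
converge. Weights near the root are controlled by mass transport: every vertex sends unit mass to
each vertex of weight above $b$ in its $r$-ball, provided both $r$-balls have at most $k$ vertices.
The expected mass received by the root is at most $k\,\mathbb{P}(\omega(\rho)>b)\le k/b$, so heavy
vertices near the root are unlikely (`exists_forall_measure_unbounded_le`). Prokhorov's theorem then
gives a limit along an ultrafilter.

The limit is a conformal metric. Forgetting weights is continuous, so the underlying graph is right.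
The Mass-Transport Principle passes to the limit for bounded continuous $F$ cut off to a clopen set
on which root distance and ball sizes are fixed, since there the mass sums are bounded and
continuous. Such $F$ determine the finite measures involved, which gives all Borel $F$
(`Unimodular.of_tendsto`).

Normalization and growth. In the limit only $\mathbb{E}\,\omega^q\le1$ survives. Passing to
$\max(\omega,1)/s$ with $s\in[1,2]$ restores norm one and shrinks distances by a factor at most 2
(`exists_normalized_conformalMetric`). Having more than $c$ points in a ball is stable under local
perturbation if the radius may grow, so the portmanteau inequality for open sets transfers bounds on
the essential supremum (`growth_le_of_tendsto`). In all, $R$ is replaced by $8R$, which costs a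
factor $8^d$ in the gauged statement and nothing in the exponent. -/

theorem mem_ball_natCast {N : Network Ξ k} {n : ℕ} {v : N.V} :
    v ∈ N.ball n ↔ ∃ i, N.graph.dist (N.root i) v ≤ n := by
  simp [ball]

theorem ball_natCast_mono (N : Network Ξ k) {m n : ℕ} (h : m ≤ n) : N.ball m ⊆ N.ball n := by
  intro v hv
  rw [mem_ball_natCast] at hv ⊢
  exact hv.imp fun i hi => hi.trans h

theorem root_mem_ball_natCast (N : Network Ξ k) (n : ℕ) (i : Fin k) : N.root i ∈ N.ball n :=
  root_mem_ball N n.cast_nonneg i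

theorem mem_ball_of_dist_le {N : Network Ξ k} {a b n : ℕ} {u v : N.V} (hu : u ∈ N.ball a)
    (huv : N.graph.dist u v ≤ b) (h : a + b ≤ n) : v ∈ N.ball n := by
  rw [mem_ball_natCast] at hu ⊢
  obtain ⟨i, hi⟩ := hu
  exact ⟨i, (N.connected.dist_triangle (v := u)).trans (by omega)⟩

theorem dist_le_one_of_adj {V : Type} {G : SimpleGraph V} {u v : V} (h : G.Adj u v) :
    G.dist u v ≤ 1 :=
  (SimpleGraph.dist_eq_one_iff_adj.2 h).le

section metric

variable [PseudoMetricSpace Ξ]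

/-- The map `f` restricts to an isomorphism between the `n`-balls which respects the roots and
changes the marks by at most `ε`. -/
structure LocalIso (n : ℕ) (ε : ℝ) (N M : Network Ξ k) (f : N.V → M.V) : Prop where
  bijOn : Set.BijOn f (N.ball n) (M.ball n)
  adj : ∀ u ∈ N.ball n, ∀ v ∈ N.ball n, (M.graph.Adj (f u) (f v) ↔ N.graph.Adj u v)
  root : ∀ i, f (N.root i) = M.root i
  mark : ∀ v ∈ N.ball n, dist (M.mark (f v)) (N.mark v) ≤ ε

/-- Total maps, with a junk value off the ball, can be restricted and rerooted without handling
subtypes of balls. -/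
theorem agree_natCast_iff {n : ℕ} {N M : Network Ξ k} :
    Agree (n : ℝ) N M ↔ ∃ f, LocalIso n (1 / n) N M f := by
  classical
  constructor
  · rintro ⟨φ, h1, h2⟩
    obtain ⟨w⟩ := M.connected.nonempty
    let f : N.V → M.V := fun v => if h : v ∈ N.ball n then (φ ⟨v, h⟩ : M.V) else w
    have hf : ∀ v (h : v ∈ N.ball n), f v = φ ⟨v, h⟩ := fun v h => dif_pos h
    refine ⟨f, ⟨fun v hv => ?_, fun u hu v hv huv => ?_, fun x hx => ?_⟩, fun u hu v hv => ?_,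
      fun i => ?_, fun v hv => ?_⟩
    · rw [hf v hv]; exact (φ ⟨v, hv⟩).2
    · rw [hf u hu, hf v hv] at huv
      exact congrArg Subtype.val (φ.injective (Subtype.ext huv))
    · refine ⟨φ.symm ⟨x, hx⟩, (φ.symm ⟨x, hx⟩).2, ?_⟩
      rw [hf _ (φ.symm ⟨x, hx⟩).2]
      simp
    · rw [hf u hu, hf v hv]
      exact φ.map_rel_iff (a := ⟨u, hu⟩) (b := ⟨v, hv⟩)
    · rw [hf _ (root_mem_ball_natCast N n i)]
      exact h1 i _
    · rw [hf v hv]; exact h2 ⟨v, hv⟩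
  · rintro ⟨f, h⟩
    refine ⟨⟨h.bijOn.equiv f, fun {a b} => h.adj a a.2 b b.2⟩, fun i _ => h.root i,
      fun v => h.mark v v.2⟩

theorem LocalIso.symm {n : ℕ} {ε : ℝ} {N M : Network Ξ k} {f : N.V → M.V}
    (h : LocalIso n ε N M f) : ∃ g, LocalIso n ε M N g ∧ ∀ v ∈ N.ball n, g (f v) = v := by
  classical
  obtain ⟨w⟩ := N.connected.nonempty
  have : Nonempty N.V := ⟨w⟩
  have hinv := h.bijOn.invOn_invFunOn
  have hb : Set.BijOn (Function.invFunOn f (N.ball n)) (M.ball n) (N.ball n) :=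
    Set.BijOn.symm hinv.symm h.bijOn
  refine ⟨Function.invFunOn f (N.ball n), ⟨hb, fun u hu v hv => ?_, fun i => ?_,
    fun v hv => ?_⟩, fun v hv => hinv.1 hv⟩
  · rw [← h.adj _ (hb.mapsTo hu) _ (hb.mapsTo hv), hinv.2 hu, hinv.2 hv]
  · rw [← h.root i]
    exact hinv.1 (root_mem_ball_natCast N n i)
  · have := h.mark _ (hb.mapsTo hv)
    rwa [hinv.2 hv, dist_comm] at this

/-- A walk of length $\ell$ starting in the $a$-ball stays in the $(a+\ell)$-ball, so `f` carries it
edge by edge. This is the source of the conditions `a + b ≤ n` below: distances are those of the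
whole graph, and geodesics must not leave the ball where `f` is controlled. -/
theorem LocalIso.dist_le_of_walk {n : ℕ} {ε : ℝ} {N M : Network Ξ k} {f : N.V → M.V}
    (h : LocalIso n ε N M f) {u v : N.V} (p : N.graph.Walk u v) :
    ∀ a : ℕ, u ∈ N.ball a → a + p.length ≤ n → M.graph.dist (f u) (f v) ≤ p.length := by
  induction p with
  | nil => simp
  | @cons u w v huw p ih =>
    intro a hu ha
    rw [SimpleGraph.Walk.length_cons] at ha ⊢
    have hw : w ∈ N.ball (a + 1 : ℕ) := mem_ball_of_dist_le hu (dist_le_one_of_adj huw) le_rfl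
    have h1 := ih (a + 1) hw (by omega)
    have h2 := (h.adj u (ball_natCast_mono N (by omega) hu) w
      (ball_natCast_mono N (by omega) hw)).2 huw
    have := (M.connected.dist_triangle (u := f u) (v := f w) (w := f v))
    have := dist_le_one_of_adj h2
    omega

theorem LocalIso.dist_le {n a b : ℕ} {ε : ℝ} {N M : Network Ξ k} {f : N.V → M.V}
    (h : LocalIso n ε N M f) {u v : N.V} (hu : u ∈ N.ball a) (huv : N.graph.dist u v ≤ b)
    (hab : a + b ≤ n) : M.graph.dist (f u) (f v) ≤ N.graph.dist u v := by
  obtain ⟨p, hp⟩ := N.connected.exists_walk_length_eq_dist u v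
  rw [← hp]
  exact h.dist_le_of_walk p a hu (by omega)

theorem LocalIso.mapsTo_ball {n a : ℕ} {ε : ℝ} {N M : Network Ξ k} {f : N.V → M.V}
    (h : LocalIso n ε N M f) (ha : a ≤ n) {u : N.V} (hu : u ∈ N.ball a) : f u ∈ M.ball a := by
  rw [mem_ball_natCast] at hu ⊢
  obtain ⟨i, hi⟩ := hu
  refine ⟨i, ?_⟩
  rw [← h.root]
  exact (h.dist_le (a := 0) (root_mem_ball_natCast N 0 i) hi (by omega)).trans hi

theorem LocalIso.dist_eq {n a b : ℕ} {ε : ℝ} {N M : Network Ξ k} {f : N.V → M.V}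
    (h : LocalIso n ε N M f) {u v : N.V} (hu : u ∈ N.ball a) (huv : N.graph.dist u v ≤ b)
    (hab : a + b ≤ n) : M.graph.dist (f u) (f v) = N.graph.dist u v := by
  have hle := h.dist_le hu huv hab
  refine le_antisymm hle ?_
  obtain ⟨g, hg, hgf⟩ := h.symm
  have h1 := hg.dist_le (h.mapsTo_ball (by omega) hu) (hle.trans huv) hab
  rwa [hgf u (ball_natCast_mono N (by omega) hu), hgf v (mem_ball_of_dist_le hu huv hab)] at h1

theorem LocalIso.bijOn_closedBall {n a b : ℕ} {ε : ℝ} {N M : Network Ξ k} {f : N.V → M.V}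
    (h : LocalIso n ε N M f) {u : N.V} (hu : u ∈ N.ball a) (hab : a + b ≤ n) :
    Set.BijOn f {v | N.graph.dist u v ≤ b} {w | M.graph.dist (f u) w ≤ b} := by
  refine ⟨fun v hv => (h.dist_le hu hv hab).trans hv, h.bijOn.injOn.mono fun v hv =>
    mem_ball_of_dist_le hu hv hab, fun w hw => ?_⟩
  obtain ⟨g, hg, hgf⟩ := h.symm
  have hu' := h.mapsTo_ball (by omega) hu
  obtain ⟨v, hv, rfl⟩ := h.bijOn.surjOn (mem_ball_of_dist_le hu' hw hab)
  refine ⟨v, ?_, rfl⟩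
  have h1 := hg.dist_le hu' hw hab
  rw [hgf u (ball_natCast_mono N (by omega) hu), hgf v hv] at h1
  exact h1.trans hw

theorem LocalIso.mono {n m : ℕ} {ε δ : ℝ} {N M : Network Ξ k} {f : N.V → M.V}
    (h : LocalIso n ε N M f) (hm : m ≤ n) (hε : ε ≤ δ) : LocalIso m δ N M f := by
  have hsub := ball_natCast_mono N hm
  refine ⟨⟨fun v hv => h.mapsTo_ball hm hv, h.bijOn.injOn.mono hsub, fun w hw => ?_⟩,
    fun u hu v hv => h.adj u (hsub hu) v (hsub hv), h.root, fun v hv =>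
    (h.mark v (hsub hv)).trans hε⟩
  obtain ⟨g, hg, hgf⟩ := h.symm
  obtain ⟨v, hv, rfl⟩ := h.bijOn.surjOn (ball_natCast_mono M hm hw)
  refine ⟨v, ?_, rfl⟩
  have := hg.mapsTo_ball hm hw
  rwa [hgf v hv] at this

/-- Local isomorphisms restrict to local isomorphisms of the networks with other roots. -/
theorem LocalIso.reroot {n a m l : ℕ} {ε : ℝ} {N M : Network Ξ k} {f : N.V → M.V}
    (h : LocalIso n ε N M f) (ρ : Fin l → N.V) (hρ : ∀ i, ρ i ∈ N.ball a) (ham : a + m ≤ n) :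
    LocalIso m ε (N.reroot ρ) (M.reroot (f ∘ ρ)) f := by
  have hsub : (N.reroot ρ).ball m ⊆ N.ball n := by
    intro v hv
    rw [mem_ball_natCast] at hv
    obtain ⟨i, hi⟩ := hv
    exact mem_ball_of_dist_le (hρ i) hi ham
  refine ⟨⟨fun v hv => ?_, h.bijOn.injOn.mono hsub, fun w hw => ?_⟩,
    fun u hu v hv => h.adj u (hsub hu) v (hsub hv), fun i => rfl, fun v hv => h.mark v (hsub hv)⟩
  · rw [mem_ball_natCast] at hv
    obtain ⟨i, hi⟩ := hv
    exact mem_ball_natCast.2 ⟨i, (h.bijOn_closedBall (hρ i) ham).mapsTo hi⟩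
  · rw [mem_ball_natCast] at hw
    obtain ⟨i, hi⟩ := hw
    obtain ⟨v, hv, rfl⟩ := (h.bijOn_closedBall (hρ i) ham).surjOn hi
    exact ⟨v, mem_ball_natCast.2 ⟨i, hv⟩, rfl⟩

/-- Compose with the identity at the radius $t$ for which $1/r+1/t=1/n$; strictness of $n<r$ makes
$t$ finite. -/
theorem Agree.natCast_of_lt {N M : Network Ξ k} {n : ℕ} {r : ℝ} (hn : 0 < n) (hr : (n : ℝ) < r)
    (h : Agree r N M) : Agree (n : ℝ) N M := by
  have hn' : (0 : ℝ) < n := by exact_mod_cast hn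
  have hr' : 0 < r := hn'.trans hr
  have hpos : 0 < 1 / (n : ℝ) - 1 / r := sub_pos.2 (one_div_lt_one_div_of_lt hn' hr)
  refine Agree.comp (t := 1 / (1 / (n : ℝ) - 1 / r)) hn' hr.le ?_ ?_ h
    ((Iso.refl M).agree (by positivity))
  · rw [le_div_iff₀ hpos, mul_sub, mul_one_div_cancel hn'.ne']
    have : 0 < n * (1 / r) := by positivity
    linarith
  · rw [one_div_one_div]; linarith

theorem Iso.agree_natCast_succ {N M : Network Ξ k} (h : Iso N M) (n : ℕ) :
    Agree ((n + 1 : ℕ) : ℝ) N M :=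
  h.agree (by positivity)

end metric

end Network

/-! ### The local topology in terms of integer radii. -/

namespace NetworkClass

open Network

variable {Ξ : Type} {k : ℕ}

theorem mk_surjective : Function.Surjective (mk : Network Ξ k → NetworkClass Ξ k) :=
  Quotient.mk_surjective

/-- The map between classes induced by a construction on networks. -/
def map {Ξ' : Type} {l : ℕ} (φ : Network Ξ k → Network Ξ' l)
    (hφ : ∀ N M, Iso N M → Iso (φ N) (φ M)) : NetworkClass Ξ k → NetworkClass Ξ' l :=
  Quotient.map φ hφ

variable [PseudoMetricSpace Ξ]

theorem dist_mk (N M : Network Ξ k) : dist (mk N) (mk M) = locDist N M := rfl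

/-- Agreement at radius $n$ and distance below $1/(1+n)$ are interchangeable as neighbourhood bases,
so every later continuity proof is a statement about local isomorphisms at a large integer radius.
-/
theorem eventually_nhds_mk {N : Network Ξ k} {p : NetworkClass Ξ k → Prop} :
    (∀ᶠ g in 𝓝 (mk N), p g) ↔ ∃ n : ℕ, 0 < n ∧ ∀ M, Agree (n : ℝ) N M → p (mk M) := by
  rw [Metric.eventually_nhds_iff]
  constructor
  · rintro ⟨ε, hε, h⟩
    obtain ⟨n, hn⟩ := exists_nat_gt (1 / ε)
    have hn0 : (0 : ℝ) < n := (by positivity : 0 < 1 / ε).trans hn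
    refine ⟨n, by exact_mod_cast hn0, fun M hM => h ?_⟩
    rw [dist_comm, dist_mk]
    refine (locDist_le hn0 hM).trans_lt ?_
    rw [div_lt_iff₀ (by positivity)]
    rw [div_lt_iff₀ hε] at hn
    nlinarith
  · rintro ⟨n, hn, h⟩
    have hn0 : (0 : ℝ) < n := by exact_mod_cast hn
    refine ⟨1 / (1 + n), by positivity, fun g hg => ?_⟩
    obtain ⟨M, rfl⟩ := mk_surjective g
    rw [dist_comm, dist_mk] at hg
    obtain ⟨r, hr, hag, hrn⟩ := exists_agree_of_locDist_lt
      (by rw [div_le_iff₀ (by positivity)]; linarith) hg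
    refine h M (hag.natCast_of_lt hn ?_)
    have := lt_of_one_div_lt_one_div (by positivity) hrn
    linarith

theorem eventually_nhds_mk_of_localIso {N : Network Ξ k} {p : NetworkClass Ξ k → Prop} {m : ℕ}
    (h : ∀ n, m ≤ n → 0 < n → ∀ M f, LocalIso n (1 / n) N M f → p (mk M)) :
    ∀ᶠ g in 𝓝 (mk N), p g := by
  refine eventually_nhds_mk.2 ⟨m + 1, by omega, fun M hM => ?_⟩
  obtain ⟨f, hf⟩ := agree_natCast_iff.1 hM
  exact h (m + 1) (by omega) (by omega) M f hf

theorem continuous_map {Ξ' : Type} [PseudoMetricSpace Ξ'] {l : ℕ}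
    (φ : Network Ξ k → Network Ξ' l) (hφ : ∀ N M, Iso N M → Iso (φ N) (φ M))
    (h : ∀ N M (n : ℕ), 0 < n → Agree (n : ℝ) N M → Agree (n : ℝ) (φ N) (φ M)) :
    Continuous (map φ hφ) := by
  rw [continuous_iff_continuousAt]
  intro g
  obtain ⟨N, rfl⟩ := mk_surjective g
  intro s hs
  have hs' : ∀ᶠ x in 𝓝 (mk (φ N)), x ∈ s := hs
  obtain ⟨n, hn, hn'⟩ := eventually_nhds_mk.1 hs'
  exact eventually_nhds_mk.2 ⟨n, hn, fun M hM => hn' _ (h N M n hn hM)⟩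

/-- The function induced by a quantity which depends only on a ball of sufficiently large
radius. -/
def liftLocal {α : Type*} (s : Network Ξ k → α)
    (h : ∀ N, ∃ n : ℕ, ∀ M, Agree ((n + 1 : ℕ) : ℝ) N M → s M = s N) : NetworkClass Ξ k → α :=
  Quotient.lift s fun N _ hNM => ((h N).choose_spec _ (hNM.agree_natCast_succ _)).symm

theorem isLocallyConstant_liftLocal {α : Type*} (s : Network Ξ k → α)
    (h : ∀ N, ∃ n : ℕ, ∀ M, Agree ((n + 1 : ℕ) : ℝ) N M → s M = s N) :
    IsLocallyConstant (liftLocal s h) := by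
  rw [IsLocallyConstant.iff_eventually_eq]
  intro g
  obtain ⟨N, rfl⟩ := mk_surjective g
  obtain ⟨n, hn⟩ := h N
  exact eventually_nhds_mk.2 ⟨n + 1, by omega, fun M hM => hn M hM⟩

end NetworkClass

/-! ### Finiteness of balls and separation -/

namespace Network

variable {Ξ : Type} {k : ℕ}

theorem exists_adj_of_dist_le_succ {V : Type} {G : SimpleGraph V} (hG : G.Connected) {u v : V}
    {n : ℕ} (h : G.dist u v ≤ n + 1) : v = u ∨ ∃ w, G.Adj v w ∧ G.dist u w ≤ n := by
  obtain ⟨p, hp⟩ := hG.exists_walk_length_eq_dist v u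
  rw [SimpleGraph.dist_comm] at hp
  cases p with
  | nil => exact Or.inl rfl
  | @cons _ w _ hvw p =>
    refine Or.inr ⟨w, hvw, ?_⟩
    rw [SimpleGraph.Walk.length_cons] at hp
    have := SimpleGraph.dist_le p.reverse
    rw [SimpleGraph.Walk.length_reverse] at this
    omega

theorem finite_closedBall (N : Network Ξ k) (u : N.V) (n : ℕ) :
    {v | N.graph.dist u v ≤ n}.Finite := by
  induction n with
  | zero =>
    refine (Set.finite_singleton u).subset fun v hv => ?_
    have : N.graph.dist u v = 0 := Nat.le_zero.1 hv
    exact (N.connected.dist_eq_zero_iff.1 this).symm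
  | succ n ih =>
    refine ((Set.finite_singleton u).union
      (ih.biUnion fun w _ => N.locallyFinite w)).subset fun v hv => ?_
    rcases exists_adj_of_dist_le_succ N.connected hv with rfl | ⟨w, hvw, hw⟩
    · exact Or.inl rfl
    · exact Or.inr (Set.mem_biUnion hw hvw.symm)

theorem finite_ball (N : Network Ξ k) (n : ℕ) : (N.ball n).Finite := by
  refine (Set.finite_iUnion fun i => N.finite_closedBall (N.root i) n).subset fun v hv => ?_
  exact Set.mem_iUnion.2 (mem_ball_natCast.1 hv)

theorem exists_mem_ball [NeZero k] (N : Network Ξ k) (v : N.V) : ∃ n : ℕ, v ∈ N.ball n :=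
  ⟨N.graph.dist (N.root 0) v, mem_ball_natCast.2 ⟨0, le_rfl⟩⟩

/-- A compactness argument: for $n\ge m$ the local isomorphisms send a vertex of the $m$-ball into a
fixed finite ball, hence their values stabilize along an ultrafilter. The limit map preserves
adjacency and roots, and marks because their error tends to 0 in a metric space. -/
theorem iso_of_forall_agree [MetricSpace Ξ] [NeZero k] {N M : Network Ξ k}
    (h : ∀ n : ℕ, 0 < n → Agree (n : ℝ) N M) : Iso N M := by
  choose f hf using fun n : ℕ => agree_natCast_iff.1 (h (n + 1) n.succ_pos)
  obtain ⟨U, hU⟩ : ∃ U : Ultrafilter ℕ, U = hyperfilter ℕ := ⟨_, rfl⟩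
  have hU' : ∀ m, ∀ᶠ n in (U : Filter ℕ), m ≤ n := fun m =>
    hU ▸ Nat.hyperfilter_le_atTop (eventually_ge_atTop m)
  have hbd : ∀ v m, v ∈ N.ball (m : ℕ) → ∀ᶠ n in (U : Filter ℕ), f n v ∈ M.ball m := by
    intro v m hv
    filter_upwards [hU' m] with n hn using (hf n).mapsTo_ball (by omega) hv
  have hlim : ∀ v, ∃ w, ∀ᶠ n in (U : Filter ℕ), f n v = w := by
    intro v
    obtain ⟨m, hm⟩ := N.exists_mem_ball v
    obtain ⟨w, -, hw⟩ := (Ultrafilter.eventually_exists_mem_iff (M.finite_ball m)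
      (f := U) (P := fun w n => f n v = w)).1
      ((hbd v m hm).mono fun n hn => ⟨_, hn, rfl⟩)
    exact ⟨w, hw⟩
  choose φ hφ using hlim
  have hadj : ∀ u v, M.graph.Adj (φ u) (φ v) ↔ N.graph.Adj u v := by
    intro u v
    obtain ⟨a, ha⟩ := N.exists_mem_ball u
    obtain ⟨b, hb⟩ := N.exists_mem_ball v
    obtain ⟨n, hu, hv, hna, hnb⟩ := ((hφ u).and ((hφ v).and ((hU' a).and (hU' b)))).exists
    rw [← hu, ← hv]
    exact (hf n).adj u (ball_natCast_mono N (by omega) ha) v (ball_natCast_mono N (by omega) hb)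
  have hinj : Function.Injective φ := by
    intro u v huv
    obtain ⟨a, ha⟩ := N.exists_mem_ball u
    obtain ⟨b, hb⟩ := N.exists_mem_ball v
    obtain ⟨n, hu, hv, hna, hnb⟩ := ((hφ u).and ((hφ v).and ((hU' a).and (hU' b)))).exists
    exact (hf n).bijOn.injOn (ball_natCast_mono N (by omega) ha)
      (ball_natCast_mono N (by omega) hb) (hu.trans (huv.trans hv.symm))
  -- The same stabilization, now applied to the preimages of `w`, which lie in a finite ball of `N`.
  have hsurj : Function.Surjective φ := by
    intro w
    obtain ⟨m, hm⟩ := M.exists_mem_ball w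
    obtain ⟨v, -, hv⟩ := (Ultrafilter.eventually_exists_mem_iff (N.finite_ball m)
      (f := U) (P := fun v n => f n v = w)).1 (by
        filter_upwards [hU' m] with n hn
        exact ((hf n).mono (by omega) le_rfl).bijOn.surjOn hm)
    obtain ⟨n, h1, h2⟩ := (hv.and (hφ v)).exists
    exact ⟨v, h2.symm.trans h1⟩
  refine ⟨⟨Equiv.ofBijective φ ⟨hinj, hsurj⟩, fun {u v} => hadj u v⟩, fun v => ?_, fun i => ?_⟩
  · change M.mark (φ v) = N.mark v
    obtain ⟨m, hm⟩ := N.exists_mem_ball v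
    refine eq_of_forall_dist_le fun ε hε => ?_
    obtain ⟨l, hl⟩ := exists_nat_one_div_lt hε
    obtain ⟨n, hv, hnm, hnl⟩ := ((hφ v).and ((hU' m).and (hU' l))).exists
    rw [← hv]
    refine ((hf n).mark v (ball_natCast_mono N (by omega) hm)).trans (le_trans ?_ hl.le)
    push_cast
    gcongr
  · obtain ⟨n, hn⟩ := (hφ (N.root i)).exists
    exact hn.symm.trans ((hf n).root i)

end Network

namespace NetworkClass

open Network

variable {Ξ : Type} {k : ℕ}

instance [MetricSpace Ξ] [NeZero k] : T0Space (NetworkClass Ξ k) := by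
  refine ⟨fun g g' h => ?_⟩
  obtain ⟨N, rfl⟩ := mk_surjective g
  obtain ⟨M, rfl⟩ := mk_surjective g'
  refine Quotient.sound (iso_of_forall_agree fun n hn => ?_)
  -- Quantifying over all representatives `L` makes this a set of classes. Agreement at radius $n+1$
  -- leaves the tolerance $1/n-1/(n+1)=1/(n(n+1))$ for the isomorphism from `M` to `L`.
  have h1 : {x : NetworkClass Ξ k | ∀ L, mk L = x → Agree ((n : ℕ) : ℝ) N L} ∈ 𝓝 (mk N) := by
    refine eventually_nhds_mk.2 ⟨n + 1, by omega, fun M hM L hL => ?_⟩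
    have hL' : Iso M L := Iso.symm (Quotient.exact hL)
    have hn' : (0 : ℝ) < n := by exact_mod_cast hn
    refine Agree.comp (s := ((n + 1 : ℕ) : ℝ)) (t := n * (n + 1)) hn' (by push_cast; linarith)
      (by nlinarith) ?_ hM (hL'.agree (by positivity))
    rw [show (1 : ℝ) / n = 1 / ((n + 1 : ℕ) : ℝ) + 1 / (n * (n + 1)) by
      push_cast; field_simp]
  rw [h.nhds_eq] at h1
  exact mem_of_mem_nhds h1 M rfl

/-! ### Continuous functionals -/

theorem mark_root_congr (i : Fin k) (N M : Network Ξ k) (h : Iso N M) :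
    N.mark (N.root i) = M.mark (M.root i) := by
  obtain ⟨φ, h1, h2⟩ := h
  rw [← h2, h1]

/-- The mark of the `i`-th root. -/
def rootMark (i : Fin k) : NetworkClass Ξ k → Ξ :=
  Quotient.lift (fun N => N.mark (N.root i)) (mark_root_congr i)

variable [PseudoMetricSpace Ξ]

/-- The number of vertices at distance at most `n` from the `i`-th root. -/
noncomputable def ballSize (i : Fin k) (n : ℕ) : NetworkClass Ξ k → ℕ :=
  liftLocal (fun N => {v | N.graph.dist (N.root i) v ≤ n}.ncard) fun N => ⟨n, fun M hM => by
    obtain ⟨f, hf⟩ := agree_natCast_iff.1 hM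
    have h := hf.bijOn_closedBall (a := 0) (b := n) (root_mem_ball_natCast N 0 i) (by omega)
    rw [hf.root] at h
    rw [← h.image_eq, h.injOn.ncard_image]⟩

theorem ballSize_mk (i : Fin k) (n : ℕ) (N : Network Ξ k) :
    ballSize i n (mk N) = {v | N.graph.dist (N.root i) v ≤ n}.ncard := rfl

theorem continuous_ballSize (i : Fin k) (n : ℕ) :
    Continuous (ballSize i n : NetworkClass Ξ k → ℕ) :=
  (isLocallyConstant_liftLocal _ _).continuous

theorem ballSize_mono (i : Fin k) {m n : ℕ} (h : m ≤ n) (g : NetworkClass Ξ k) :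
    ballSize i m g ≤ ballSize i n g := by
  obtain ⟨N, rfl⟩ := mk_surjective g
  exact Set.ncard_le_ncard (fun v hv => le_trans (α := ℕ) hv h) (N.finite_closedBall _ _)

/-- The graph distance between two roots. -/
noncomputable def rootDist (i j : Fin k) : NetworkClass Ξ k → ℕ :=
  liftLocal (fun N => N.graph.dist (N.root i) (N.root j)) fun N =>
    ⟨N.graph.dist (N.root i) (N.root j), fun M hM => by
      obtain ⟨f, hf⟩ := agree_natCast_iff.1 hM
      have h := hf.dist_eq (a := 0) (root_mem_ball_natCast N 0 i) (le_refl
        (N.graph.dist (N.root i) (N.root j))) (by omega)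
      rwa [hf.root, hf.root] at h⟩

theorem continuous_rootDist (i j : Fin k) :
    Continuous (rootDist i j : NetworkClass Ξ k → ℕ) :=
  (isLocallyConstant_liftLocal _ _).continuous

theorem continuous_rootMark (i : Fin k) : Continuous (rootMark i : NetworkClass Ξ k → Ξ) := by
  rw [continuous_iff_continuousAt]
  intro g
  obtain ⟨N, rfl⟩ := mk_surjective g
  refine Metric.tendsto_nhds.2 fun ε hε => ?_
  obtain ⟨m, hm⟩ := exists_nat_one_div_lt hε
  refine eventually_nhds_mk_of_localIso (m := m + 1) fun n hmn hn M f hf => ?_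
  change dist (M.mark (M.root i)) (N.mark (N.root i)) < ε
  rw [← hf.root i]
  refine (hf.mark _ (root_mem_ball_natCast N n i)).trans_lt (lt_of_le_of_lt ?_ hm)
  have : ((m : ℝ) + 1) ≤ n := by exact_mod_cast hmn
  gcongr

/-- The exchange of the two roots. -/
def swap : NetworkClass Ξ 2 → NetworkClass Ξ 2 :=
  map (fun N => N.reroot ![N.root 1, N.root 0]) fun N M ⟨φ, h1, h2⟩ => ⟨φ, h1, fun i => by
    fin_cases i
    · exact h2 1
    · exact h2 0⟩

end NetworkClass

/-! ### Transformation of marks, and mass sums. -/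

namespace Network

variable {Ξ Ξ' : Type} {k : ℕ}

/-- The network with marks transformed by `f`. -/
def mapMark (f : Ξ → Ξ') (N : Network Ξ k) : Network Ξ' k :=
  ⟨N.V, N.graph, N.connected, N.locallyFinite, fun v => f (N.mark v), N.root⟩

theorem mapMark_congr (f : Ξ → Ξ') (N M : Network Ξ k) (h : Iso N M) :
    Iso (N.mapMark f) (M.mapMark f) := by
  obtain ⟨φ, h1, h2⟩ := h
  exact ⟨φ, fun v => congrArg f (h1 v), h2⟩

end Network

namespace NetworkClass

open Network

variable {Ξ Ξ' : Type} {k : ℕ}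

/-- The map between classes which transforms the marks by `f`. -/
def mapMark (f : Ξ → Ξ') : NetworkClass Ξ k → NetworkClass Ξ' k :=
  map (Network.mapMark f) (mapMark_congr f)

theorem continuous_mapMark [PseudoMetricSpace Ξ] [PseudoMetricSpace Ξ'] {f : Ξ → Ξ'}
    (hf : LipschitzWith 1 f) : Continuous (mapMark f : NetworkClass Ξ k → NetworkClass Ξ' k) := by
  refine continuous_map _ _ fun N M n hn h => ?_
  rw [agree_natCast_iff] at h ⊢
  obtain ⟨φ, hφ⟩ := h
  refine ⟨φ, hφ.bijOn, hφ.adj, hφ.root, fun v hv => ?_⟩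
  have := hf.dist_le_mul (M.mark (φ v)) (N.mark v)
  rw [NNReal.coe_one, one_mul] at this
  exact this.trans (hφ.mark v hv)

/-- The sum of `F` over all choices of a second root. -/
noncomputable def massOut (F : NetworkClass Ξ 2 → ℝ≥0∞) : NetworkClass Ξ 1 → ℝ≥0∞ :=
  Quotient.lift (Network.massOut F) fun _ _ h => Network.massOut_congr F h

theorem massOut_mk (F : NetworkClass Ξ 2 → ℝ≥0∞) (N : Network Ξ 1) :
    massOut F (mk N) = ∑' x : N.V, F (mk (N.reroot ![N.root 0, x])) := rfl

/-- Received mass is sent mass for the swapped function, so only `massOut` needs to be studied. -/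
theorem lift_massIn_eq (F : NetworkClass Ξ 2 → ℝ≥0∞) (g : NetworkClass Ξ 1) :
    Quotient.lift (Network.massIn F) (fun _ _ h => Network.massIn_congr F h) g =
      massOut (F ∘ swap) g := by
  obtain ⟨N, rfl⟩ := mk_surjective g
  rfl

theorem massOut_mapMark (f : Ξ → Ξ') (F : NetworkClass Ξ' 2 → ℝ≥0∞) (g : NetworkClass Ξ 1) :
    massOut F (mapMark f g) = massOut (F ∘ mapMark f) g := by
  obtain ⟨N, rfl⟩ := mk_surjective g
  rfl

theorem swap_mapMark (f : Ξ → Ξ') (g : NetworkClass Ξ 2) :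
    swap (mapMark f g) = mapMark f (swap g) := by
  obtain ⟨N, rfl⟩ := mk_surjective g
  rfl

variable [PseudoMetricSpace Ξ]

theorem continuous_swap : Continuous (swap : NetworkClass Ξ 2 → NetworkClass Ξ 2) := by
  refine continuous_map _ _ fun N M n hn h => ?_
  rw [agree_natCast_iff] at h ⊢
  obtain ⟨f, hf⟩ := h
  have h1 := hf.reroot (a := 0) (m := n) ![N.root 1, N.root 0]
    (fun i => by fin_cases i <;> exact root_mem_ball_natCast N 0 _) (by omega)
  have h2 : f ∘ ![N.root 1, N.root 0] = ![M.root 1, M.root 0] := by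
    funext i
    fin_cases i
    · exact hf.root 1
    · exact hf.root 0
  rw [h2] at h1
  exact ⟨f, h1⟩

theorem ballSize_swap (i : Fin 2) (n : ℕ) (g : NetworkClass Ξ 2) :
    ballSize i n (swap g) = ballSize (1 - i) n g := by
  obtain ⟨N, rfl⟩ := mk_surjective g
  fin_cases i <;> rfl

theorem rootDist_swap (g : NetworkClass Ξ 2) : rootDist 0 1 (swap g) = rootDist 0 1 g := by
  obtain ⟨N, rfl⟩ := mk_surjective g
  exact SimpleGraph.dist_comm

theorem massOut_mk_eq_sum {F : NetworkClass Ξ 2 → ℝ≥0∞} {r : ℕ}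
    (hF : ∀ g, r < rootDist 0 1 g → F g = 0) (N : Network Ξ 1) {s : Finset N.V}
    (hs : {v | N.graph.dist (N.root 0) v ≤ r} ⊆ s) :
    massOut F (mk N) = ∑ x ∈ s, F (mk (N.reroot ![N.root 0, x])) := by
  rw [massOut_mk]
  refine tsum_eq_sum fun x hx => hF _ ?_
  change r < N.graph.dist (N.root 0) x
  by_contra! hcon
  exact hx (hs hcon)

theorem massOut_le_ballSize_mul {F : NetworkClass Ξ 2 → ℝ≥0∞} {r : ℕ}
    (hF : ∀ g, r < rootDist 0 1 g → F g = 0) {c : ℝ≥0∞} (hc : ∀ g, F g ≤ c)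
    (g : NetworkClass Ξ 1) : massOut F g ≤ ballSize 0 r g * c := by
  obtain ⟨N, rfl⟩ := mk_surjective g
  have hfin := N.finite_closedBall (N.root 0) r
  rw [massOut_mk_eq_sum hF N (s := hfin.toFinset) (by simp), ballSize_mk,
    Set.ncard_eq_toFinset_card _ hfin, ← nsmul_eq_mul]
  exact Finset.sum_le_card_nsmul _ _ _ fun x _ => hc _

/-- With finite range the sum runs over the finite $r$-ball. A local isomorphism of large radius
matches its terms with those of a nearby network, and the rerooted networks are close term by term.
-/
theorem continuous_massOut {F : NetworkClass Ξ 2 → ℝ≥0} (hF : Continuous F) {r : ℕ}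
    (hr : ∀ g, r < rootDist 0 1 g → F g = 0) :
    Continuous (massOut fun g => (F g : ℝ≥0∞)) := by
  classical
  have hr' : ∀ g : NetworkClass Ξ 2, r < rootDist 0 1 g → (F g : ℝ≥0∞) = 0 := fun g hg => by
    rw [hr g hg, ENNReal.coe_zero]
  rw [continuous_iff_continuousAt]
  intro g
  obtain ⟨N, rfl⟩ := mk_surjective g
  have hfin := N.finite_closedBall (N.root 0) r
  obtain ⟨s, hs⟩ : ∃ s, s = hfin.toFinset := ⟨_, rfl⟩
  have hs' : {v | N.graph.dist (N.root 0) v ≤ r} = s := by rw [hs, hfin.coe_toFinset]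
  intro U hU
  rw [massOut_mk_eq_sum hr' N hs'.subset] at hU
  have hΦ : Continuous fun y : s → ℝ≥0 => ∑ x, (y x : ℝ≥0∞) := by fun_prop
  have hy : (fun y : s → ℝ≥0 => ∑ x, (y x : ℝ≥0∞)) ⁻¹' U ∈
      𝓝 (fun x : s => F (mk (N.reroot ![N.root 0, (x : N.V)]))) := by
    refine hΦ.continuousAt ?_
    change U ∈ 𝓝 (∑ x : s, (F (mk (N.reroot ![N.root 0, (x : N.V)])) : ℝ≥0∞))
    rwa [Finset.sum_coe_sort s fun x => (F (mk (N.reroot ![N.root 0, x])) : ℝ≥0∞)]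
  rw [nhds_pi, Filter.mem_pi] at hy
  obtain ⟨I, -, t, ht, hIt⟩ := hy
  choose m hm0 hm using fun x : s => eventually_nhds_mk.1 (hF.continuousAt.eventually (ht x))
  -- The second root is within `r` of the first, so radius `r + m x` contains the ball of radius `m
  -- x` around both, as continuity of `F` at `x` demands.
  refine eventually_nhds_mk_of_localIso (m := r + Finset.univ.sup m) fun n hn hn0 M f hf => ?_
  have hroot : ∀ i, N.root i ∈ N.ball (0 : ℕ) := root_mem_ball_natCast N 0
  have hb := hf.bijOn_closedBall (b := r) (hroot 0) (by omega)
  rw [hf.root, hs'] at hb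
  change massOut (fun g => (F g : ℝ≥0∞)) (mk M) ∈ U
  rw [massOut_mk_eq_sum hr' M (s := s.image f) (by rw [← hb.image_eq, Finset.coe_image]),
    Finset.sum_image hb.injOn, ← Finset.sum_coe_sort s]
  refine hIt (a := fun x : s => F (mk (M.reroot ![M.root 0, f x]))) fun x _ => ?_
  refine hm x _ (agree_natCast_iff.2 ⟨f, ?_⟩)
  have hle : m x ≤ Finset.univ.sup m := Finset.le_sup (Finset.mem_univ x)
  have h1 := (hf.mono (m := r + m x) (by omega) (δ := 1 / m x) (by
    have h2 : m x ≤ n := by omega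
    have h3 : 0 < m x := hm0 x
    gcongr)).reroot (a := r) (m := m x) ![N.root 0, (x : N.V)] (fun i => by
      fin_cases i
      · exact root_mem_ball_natCast N r 0
      · exact mem_ball_natCast.2 ⟨0, hs'.superset x.2⟩) le_rfl
  have h2 : f ∘ ![N.root 0, (x : N.V)] = ![M.root 0, f x] := by
    funext i
    fin_cases i
    · exact hf.root 0
    · rfl
  rwa [h2] at h1

end NetworkClass

/-! ### Measurability of mass sums and weak limits of unimodular laws -/

namespace NetworkClass

open Network

variable {Ξ : Type} [PseudoMetricSpace Ξ]

/-- Doubly rooted networks with prescribed distance of the roots, and prescribed sizes of the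
balls around the roots whose radius is this distance. -/
def cell (t : ℕ × ℕ × ℕ) : Set (NetworkClass Ξ 2) :=
  {g | rootDist 0 1 g = t.1 ∧ ballSize 0 t.1 g = t.2.1 ∧ ballSize 1 t.1 g = t.2.2}

/-- Because cells are clopen, cutting off to one preserves continuity. The recorded distance gives
finite range and the first ball size bounds the number of terms; the second ball size is recorded so
that the family of cells is invariant under `swap`. -/
theorem isClopen_cell (t : ℕ × ℕ × ℕ) : IsClopen (cell t : Set (NetworkClass Ξ 2)) :=
  ((isClopen_discrete {t.1}).preimage (continuous_rootDist 0 1)).inter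
    (((isClopen_discrete {t.2.1}).preimage (continuous_ballSize 0 t.1)).inter
      ((isClopen_discrete {t.2.2}).preimage (continuous_ballSize 1 t.1)))

theorem swap_preimage_cell (t : ℕ × ℕ × ℕ) :
    (swap : NetworkClass Ξ 2 → NetworkClass Ξ 2) ⁻¹' cell t = cell (t.1, t.2.2, t.2.1) := by
  ext g
  simp only [cell, Set.mem_preimage, Set.mem_ofPred_eq, rootDist_swap, ballSize_swap]
  exact and_congr_right fun _ => and_comm

theorem tsum_indicator_cell (F : NetworkClass Ξ 2 → ℝ≥0∞) (g : NetworkClass Ξ 2) :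
    ∑' t, (cell t).indicator F g = F g := by
  rw [tsum_eq_single (rootDist 0 1 g, ballSize 0 (rootDist 0 1 g) g,
    ballSize 1 (rootDist 0 1 g) g)]
  · exact Set.indicator_of_mem (s := cell _) ⟨rfl, rfl, rfl⟩ F
  · rintro ⟨r, a, b⟩ ht
    refine Set.indicator_of_notMem (s := cell _) (fun h => ht ?_) F
    obtain ⟨h1, h2, h3⟩ := h
    change rootDist 0 1 g = r at h1
    subst h1
    rw [h2, h3]

theorem massOut_eq_tsum_cell (F : NetworkClass Ξ 2 → ℝ≥0∞) (g : NetworkClass Ξ 1) :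
    massOut F g = ∑' t, massOut ((cell t).indicator F) g := by
  obtain ⟨N, rfl⟩ := mk_surjective g
  simp_rw [massOut_mk]
  rw [ENNReal.tsum_comm]
  exact tsum_congr fun x => (tsum_indicator_cell F _).symm

theorem massOut_indicator_cell_le (t : ℕ × ℕ × ℕ) {F : NetworkClass Ξ 2 → ℝ≥0∞} {c : ℝ≥0∞}
    (hF : ∀ g, F g ≤ c) (g : NetworkClass Ξ 1) :
    massOut ((cell t).indicator F) g ≤ t.2.1 * c := by
  by_cases h : ballSize 0 t.1 g = t.2.1
  · rw [← h]
    refine massOut_le_ballSize_mul (fun g hg => Set.indicator_of_notMem (fun h' => ?_) F)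
      (fun g => (Set.indicator_le_self _ F g).trans (hF g)) g
    exact hg.ne' h'.1
  · obtain ⟨N, rfl⟩ := mk_surjective g
    rw [massOut_mk, ENNReal.tsum_eq_zero.2]
    · exact zero_le
    · exact fun x => Set.indicator_of_notMem (fun h' => h h'.2.1) F

theorem continuous_massOut_indicator_cell (t : ℕ × ℕ × ℕ) {F : NetworkClass Ξ 2 → ℝ≥0}
    (hF : Continuous F) :
    Continuous (massOut ((cell t).indicator fun g => (F g : ℝ≥0∞))) := by
  have h := continuous_massOut (F := (cell t).indicator F) (r := t.1)
    (hF.indicator (by simp [(isClopen_cell t).frontier_eq]))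
    (fun g hg => Set.indicator_of_notMem (fun h' => hg.ne' h'.1) F)
  convert h using 2
  funext g
  by_cases hg : g ∈ cell t
  · simp [hg]
  · simp [hg]

/-- The counting measure on the second roots for which the doubly rooted network is in a given
cell. -/
noncomputable def cellMeasure (t : ℕ × ℕ × ℕ) (g : NetworkClass Ξ 1) :
    Measure (NetworkClass Ξ 2) :=
  (Measure.sum fun x : (Quotient.out g).V =>
    Measure.dirac (mk ((Quotient.out g).reroot ![(Quotient.out g).root 0, x]))).restrict (cell t)

theorem lintegral_cellMeasure (t : ℕ × ℕ × ℕ) (g : NetworkClass Ξ 1)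
    {F : NetworkClass Ξ 2 → ℝ≥0∞} (hF : Measurable F) :
    ∫⁻ x, F x ∂cellMeasure t g = massOut ((cell t).indicator F) g := by
  have hm := (isClopen_cell (Ξ := Ξ) t).isOpen.measurableSet
  rw [cellMeasure, ← lintegral_indicator hm, lintegral_sum_measure]
  conv_rhs => rw [← Quotient.out_eq g]
  exact tsum_congr fun x => lintegral_dirac' _ (hF.indicator hm)

theorem cellMeasure_univ_le (t : ℕ × ℕ × ℕ) (g : NetworkClass Ξ 1) :
    cellMeasure t g Set.univ ≤ t.2.1 := by
  rw [← lintegral_one, lintegral_cellMeasure t g measurable_const]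
  simpa using massOut_indicator_cell_le t (fun _ => le_refl (1 : ℝ≥0∞)) g

instance (t : ℕ × ℕ × ℕ) (g : NetworkClass Ξ 1) : IsFiniteMeasure (cellMeasure t g) :=
  ⟨(cellMeasure_univ_le t g).trans_lt (ENNReal.natCast_lt_top _)⟩

/-- The measure of a closed set is a decreasing limit of integrals of continuous functions, and
those integrals are continuous in the network; closed sets are a generating π-system. Being a kernel
then yields measurability of mass sums for every Borel function. -/
theorem measurable_cellMeasure (t : ℕ × ℕ × ℕ) :
    Measurable (cellMeasure t : NetworkClass Ξ 1 → Measure (NetworkClass Ξ 2)) := by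
  have hclosed : ∀ C : Set (NetworkClass Ξ 2), IsClosed C →
      Measurable fun g => cellMeasure t g C := by
    intro C hC
    refine measurable_of_tendsto_metrizable
      (f := fun n g => ∫⁻ x, (hC.apprSeq n x : ℝ≥0∞) ∂cellMeasure t g) (fun n => ?_) ?_
    · simp_rw [lintegral_cellMeasure t _ (hC.apprSeq n).measurable_coe_ennreal_comp]
      exact (continuous_massOut_indicator_cell t (hC.apprSeq n).continuous).measurable
    · exact tendsto_pi_nhds.2 fun g => HasOuterApproxClosed.tendsto_lintegral_apprSeq hC _
  refine Measurable.measure_of_isPiSystem ?_ isPiSystem_isClosed hclosed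
    (hclosed _ isClosed_univ)
  rw [← borel_eq_generateFrom_isClosed]
  rfl

theorem massOut_eq_tsum_lintegral {F : NetworkClass Ξ 2 → ℝ≥0∞} (hF : Measurable F)
    (g : NetworkClass Ξ 1) : massOut F g = ∑' t, ∫⁻ x, F x ∂cellMeasure t g := by
  rw [massOut_eq_tsum_cell]
  exact tsum_congr fun t => (lintegral_cellMeasure t g hF).symm

theorem measurable_lintegral_cellMeasure (t : ℕ × ℕ × ℕ) {F : NetworkClass Ξ 2 → ℝ≥0∞}
    (hF : Measurable F) : Measurable fun g => ∫⁻ x, F x ∂cellMeasure t g :=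
  (Measure.measurable_lintegral hF).comp (measurable_cellMeasure t)

theorem measurable_massOut {F : NetworkClass Ξ 2 → ℝ≥0∞} (hF : Measurable F) :
    Measurable (massOut F) := by
  simp_rw [funext (massOut_eq_tsum_lintegral hF)]
  exact Measurable.tsum fun t => measurable_lintegral_cellMeasure t hF

end NetworkClass

/-! ### The Mass-Transport Principle for weak limits. -/

open NetworkClass

theorem unimodular_iff {Ξ : Type} [PseudoMetricSpace Ξ]
    {P : ProbabilityMeasure (NetworkClass Ξ 1)} :
    Unimodular P ↔ ∀ F : NetworkClass Ξ 2 → ℝ≥0∞, Measurable F →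
      ∫⁻ g, massOut F g ∂(P : Measure (NetworkClass Ξ 1)) =
        ∫⁻ g, massOut (F ∘ swap) g ∂(P : Measure (NetworkClass Ξ 1)) := by
  simp_rw [Unimodular, lift_massIn_eq]
  rfl

theorem tendsto_lintegral_of_continuous_of_le {X ι : Type*} [TopologicalSpace X]
    [MeasurableSpace X] [OpensMeasurableSpace X] {l : Filter ι} {Q : ι → ProbabilityMeasure X}
    {Q' : ProbabilityMeasure X} (h : Tendsto Q l (𝓝 Q')) {f : X → ℝ≥0∞} (hf : Continuous f)
    {c : ℝ≥0} (hc : ∀ x, f x ≤ c) :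
    Tendsto (fun i => ∫⁻ x, f x ∂(Q i : Measure X)) l (𝓝 (∫⁻ x, f x ∂(Q' : Measure X))) := by
  have hne : ∀ x, f x ≠ ∞ := fun x => ((hc x).trans_lt ENNReal.coe_lt_top).ne
  have hcont : Continuous fun x => (f x).toNNReal :=
    ENNReal.continuousOn_toNNReal.comp_continuous hf hne
  have hle : ∀ x, (f x).toNNReal ≤ c := fun x => by simpa using ENNReal.toNNReal_mono ENNReal.coe_ne_top (hc x)
  have := ProbabilityMeasure.tendsto_iff_forall_lintegral_tendsto.1 h
    (BoundedContinuousFunction.mkOfBound ⟨fun x => (f x).toNNReal, hcont⟩ c fun x y => by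
      rw [ContinuousMap.coe_mk, NNReal.dist_eq, abs_sub_le_iff]
      have h1 : ((f x).toNNReal : ℝ) ≤ c := hle x
      have h2 : ((f y).toNNReal : ℝ) ≤ c := hle y
      have h3 := (f x).toNNReal.coe_nonneg
      have h4 := (f y).toNNReal.coe_nonneg
      constructor <;> linarith)
  simpa [ENNReal.coe_toNNReal (hne _)] using this

/-- Weak limits of unimodular laws are unimodular. -/
theorem Unimodular.of_tendsto {ι : Type*} {Ξ : Type} [PseudoMetricSpace Ξ] {l : Filter ι}
    [l.NeBot] {Q : ι → ProbabilityMeasure (NetworkClass Ξ 1)}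
    {Q' : ProbabilityMeasure (NetworkClass Ξ 1)} (hQ : ∀ i, Unimodular (Q i))
    (h : Tendsto Q l (𝓝 Q')) : Unimodular Q' := by
  have hswap : Measurable (swap : NetworkClass Ξ 2 → NetworkClass Ξ 2) :=
    continuous_swap.measurable
  have hcomp : ∀ (t : ℕ × ℕ × ℕ) (F : NetworkClass Ξ 2 → ℝ≥0∞),
      (cell t).indicator F ∘ swap = (cell (t.1, t.2.2, t.2.1)).indicator (F ∘ swap) := by
    intro t F
    rw [← swap_preimage_cell]
    exact funext fun g => (Set.indicator_comp_right swap).symm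
  -- On one cell the principle is an equality of two finite measures, so it is enough to test
  -- bounded continuous functions. For these both mass sums are bounded and continuous, and the
  -- equality is inherited from the `Q i`.
  have hcell : ∀ t : ℕ × ℕ × ℕ, (Q' : Measure (NetworkClass Ξ 1)).bind (cellMeasure t) =
      ((Q' : Measure (NetworkClass Ξ 1)).bind (cellMeasure (t.1, t.2.2, t.2.1))).map swap := by
    intro t
    have hfin : ∀ t : ℕ × ℕ × ℕ,
        IsFiniteMeasure ((Q' : Measure (NetworkClass Ξ 1)).bind (cellMeasure t)) := by
      intro t
      refine ⟨?_⟩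
      rw [← lintegral_one, Measure.lintegral_bind (measurable_cellMeasure t).aemeasurable
        aemeasurable_const]
      simp_rw [lintegral_one]
      refine (lintegral_mono fun g => cellMeasure_univ_le t g).trans_lt ?_
      rw [lintegral_const, measure_univ, mul_one]
      exact ENNReal.natCast_lt_top _
    have h1 := hfin t
    have h2 := hfin (t.1, t.2.2, t.2.1)
    refine ext_of_forall_lintegral_eq_of_IsFiniteMeasure fun f => ?_
    have hf : Measurable fun x => (f x : ℝ≥0∞) := f.measurable_coe_ennreal_comp
    have hfs : Measurable fun x => (f (swap x) : ℝ≥0∞) := hf.comp hswap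
    rw [lintegral_map hf hswap, Measure.lintegral_bind (measurable_cellMeasure _).aemeasurable
      hf.aemeasurable, Measure.lintegral_bind (measurable_cellMeasure _).aemeasurable
      hfs.aemeasurable]
    simp_rw [lintegral_cellMeasure _ _ hf, lintegral_cellMeasure _ _ hfs]
    obtain ⟨c, hc⟩ : ∃ c : ℝ≥0, ∀ x, f x ≤ c := ⟨_, f.apply_le_nndist_zero⟩
    have hc' : ∀ x, (f x : ℝ≥0∞) ≤ c := fun x => ENNReal.coe_le_coe.2 (hc x)
    have lim1 := tendsto_lintegral_of_continuous_of_le h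
      (continuous_massOut_indicator_cell t f.continuous) (c := t.2.1 * c) (fun g => by
        push_cast; exact massOut_indicator_cell_le t hc' g)
    have lim2 := tendsto_lintegral_of_continuous_of_le h
      (continuous_massOut_indicator_cell (t.1, t.2.2, t.2.1) (f.continuous.comp continuous_swap))
      (c := t.2.2 * c) (fun g => by
        push_cast; exact massOut_indicator_cell_le (t.1, t.2.2, t.2.1) (fun x => hc' (swap x)) g)
    refine tendsto_nhds_unique lim1 (lim2.congr fun i => ?_)
    have := unimodular_iff.1 (hQ i) ((cell t).indicator fun x => (f x : ℝ≥0∞))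
      (hf.indicator (isClopen_cell t).isOpen.measurableSet)
    rw [this, hcomp]
    rfl
  rw [unimodular_iff]
  intro F hF
  have hFs : Measurable (F ∘ swap) := hF.comp hswap
  -- Reindexing by the exchange of the two ball sizes pairs each cell with its image under `swap`.
  have e : ∀ g : NetworkClass Ξ 1, massOut (F ∘ swap) g =
      ∑' t : ℕ × ℕ × ℕ, ∫⁻ x, (F ∘ swap) x ∂cellMeasure (t.1, t.2.2, t.2.1) g := by
    intro g
    rw [massOut_eq_tsum_lintegral hFs]
    exact (Equiv.tsum_eq ((Equiv.refl ℕ).prodCongr (Equiv.prodComm ℕ ℕ)) _).symm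
  simp_rw [e, massOut_eq_tsum_lintegral hF]
  rw [lintegral_tsum fun t => (measurable_lintegral_cellMeasure t hF).aemeasurable,
    lintegral_tsum fun t => (measurable_lintegral_cellMeasure _ hFs).aemeasurable]
  refine tsum_congr fun t => ?_
  have := congrArg (fun μ => ∫⁻ x, F x ∂μ) (hcell t)
  rw [lintegral_map hF hswap, Measure.lintegral_bind (measurable_cellMeasure _).aemeasurable
      hF.aemeasurable] at this
  exact this.trans (Measure.lintegral_bind (measurable_cellMeasure _).aemeasurable
    hFs.aemeasurable)

/-- Unimodularity is preserved by a measurable transformation of the marks. -/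
theorem Unimodular.map_mapMark {Ξ Ξ' : Type} [PseudoMetricSpace Ξ] [PseudoMetricSpace Ξ']
    {f : Ξ → Ξ'} (hf : LipschitzWith 1 f) {Q : ProbabilityMeasure (NetworkClass Ξ 1)}
    (hQ : Unimodular Q) :
    Unimodular (Q.map (continuous_mapMark hf).measurable.aemeasurable) := by
  rw [unimodular_iff] at hQ ⊢
  intro F hF
  have hm2 : Measurable (mapMark f : NetworkClass Ξ 2 → NetworkClass Ξ' 2) :=
    (continuous_mapMark hf).measurable
  have hm : Measurable (mapMark f : NetworkClass Ξ 1 → NetworkClass Ξ' 1) :=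
    (continuous_mapMark hf).measurable
  rw [ProbabilityMeasure.toMeasure_map, lintegral_map (measurable_massOut hF) hm,
    lintegral_map (measurable_massOut (hF.comp continuous_swap.measurable)) hm]
  simp_rw [massOut_mapMark]
  rw [hQ _ (hF.comp hm2)]
  have : (F ∘ mapMark f) ∘ swap = (F ∘ swap) ∘ mapMark f := by
    funext x
    simp [swap_mapMark]
  rw [this]

/-! ### Compact sets of rooted networks -/

namespace Network

/-- Rooted networks for which the number of vertices of the `r`-ball is at most `b r` and the marks
in the `r`-ball belong to `C r`, for all `r`. -/
def boundedBalls {Ξ : Type} (b : ℕ → ℕ) (C : ℕ → Set Ξ) : Set (Network Ξ 1) :=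
  {N | ∀ r, {v | N.graph.dist (N.root 0) v ≤ r}.ncard ≤ b r ∧
    ∀ v, N.graph.dist (N.root 0) v ≤ r → N.mark v ∈ C r}

variable {Ξ : Type}

theorem mem_ball_one {N : Network Ξ 1} {n : ℕ} {v : N.V} :
    v ∈ N.ball n ↔ N.graph.dist (N.root 0) v ≤ n := by
  simp [mem_ball_natCast]

/-- Labelling a vertex by its distance to the root and an index in the ball of that radius puts all
the networks on one label set, with finitely many labels up to any given distance. -/
theorem exists_code (N : Network Ξ 1) {b : ℕ → ℕ}
    (h : ∀ r, {v | N.graph.dist (N.root 0) v ≤ r}.ncard ≤ b r) :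
    ∃ e : N.V → ℕ × ℕ, Function.Injective e ∧
      ∀ v, (e v).1 = N.graph.dist (N.root 0) v ∧ (e v).2 < b (e v).1 := by
  classical
  have hidx : ∀ r, ∃ j : N.V → ℕ, Set.InjOn j {v | N.graph.dist (N.root 0) v ≤ r} ∧
      ∀ v, N.graph.dist (N.root 0) v ≤ r → j v < b r := by
    intro r
    have hfin := N.finite_closedBall (N.root 0) r
    have hcard := h r
    rw [Set.ncard_eq_toFinset_card _ hfin] at hcard
    have hmem : ∀ v, v ∈ hfin.toFinset ↔ N.graph.dist (N.root 0) v ≤ r := by simp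
    refine ⟨fun v => if hv : v ∈ hfin.toFinset then hfin.toFinset.equivFin ⟨v, hv⟩ else 0,
      fun u hu v hv huv => ?_, fun v hv => ?_⟩
    · have hu' := (hmem u).2 hu
      have hv' := (hmem v).2 hv
      simp only [dif_pos hu', dif_pos hv'] at huv
      exact congrArg Subtype.val (hfin.toFinset.equivFin.injective (Fin.ext huv))
    · simp only [dif_pos ((hmem v).2 hv)]
      exact (Fin.is_lt _).trans_le hcard
  choose j hj hjb using hidx
  refine ⟨fun v => (N.graph.dist (N.root 0) v, j (N.graph.dist (N.root 0) v) v),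
    fun u v huv => ?_, fun v => ⟨rfl, hjb _ v le_rfl⟩⟩
  obtain ⟨h1, h2⟩ := Prod.mk.inj huv
  rw [h1] at h2
  exact hj _ (Set.mem_ofPred.2 h1.le) (Set.mem_ofPred.2 le_rfl) h2

theorem finite_codes (b : ℕ → ℕ) (r : ℕ) : {c : ℕ × ℕ | c.1 ≤ r ∧ c.2 < b c.1}.Finite := by
  refine ((Set.finite_Iic r).biUnion fun d _ =>
    (Set.finite_Iio (b d)).image (Prod.mk d)).subset ?_
  rintro ⟨d, j⟩ ⟨h1, h2⟩
  exact Set.mem_biUnion (x := d) h1 ⟨j, h2, rfl⟩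

/-- Networks with uniformly bounded balls have limits along ultrafilters. -/
theorem exists_tendsto_ultrafilter [PseudoMetricSpace Ξ] {ι : Type*} (U : Ultrafilter ι)
    {b : ℕ → ℕ} {C : ℕ → Set Ξ} (hC : ∀ r, IsCompact (C r)) (hCmono : Monotone C)
    (N : ι → Network Ξ 1)
    (hN : ∀ i, N i ∈ boundedBalls b C) :
    ∃ L ∈ boundedBalls b C,
      Tendsto (fun i => NetworkClass.mk (N i)) U (𝓝 (NetworkClass.mk L)) := by
  classical
  choose e he hed using fun i => (N i).exists_code fun r => (hN i r).1
  have hcode : ∀ (v : ∀ i, (N i).V) (r : ℕ),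
      (∀ᶠ i in U, (N i).graph.dist ((N i).root 0) (v i) ≤ r) → ∃ c, ∀ᶠ i in U, e i (v i) = c := by
    intro v r hv
    obtain ⟨c, -, hc⟩ := (Ultrafilter.eventually_exists_mem_iff (finite_codes b r)
      (f := U) (P := fun c i => e i (v i) = c)).1 (by
        filter_upwards [hv] with i hi
        exact ⟨_, ⟨(hed i (v i)).1.trans_le hi, (hed i (v i)).2⟩, rfl⟩)
    exact ⟨c, hc⟩
  -- `x i c` is the vertex of `N i` labelled `c`, with the root as default value. The limit network
  -- lives on the set `W` of labels that occur for almost all `i`.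
  let x : ∀ i, ℕ × ℕ → (N i).V := fun i c =>
    if h : ∃ v, e i v = c then h.choose else (N i).root 0
  have hx : ∀ i v, x i (e i v) = v := by
    intro i v
    have h : ∃ u, e i u = e i v := ⟨v, rfl⟩
    refine he i ?_
    simp only [x, dif_pos h]
    exact h.choose_spec
  let W : Set (ℕ × ℕ) := {c | ∀ᶠ i in U, ∃ v, e i v = c}
  have hW : ∀ c : W, ∀ᶠ i in U, e i (x i c) = c := by
    intro c
    filter_upwards [c.2] with i hi
    obtain ⟨v, hv⟩ := hi
    rw [← hv, hx]
  have hWd : ∀ c : W, ∀ᶠ i in U, (N i).graph.dist ((N i).root 0) (x i c) = c.1.1 := by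
    intro c
    filter_upwards [hW c] with i hi
    rw [← (hed i _).1, hi]
  -- Any choice of vertices at bounded distance from the roots is represented by a single vertex of
  -- the limit.
  have hexists : ∀ (v : ∀ i, (N i).V) (r : ℕ),
      (∀ᶠ i in U, (N i).graph.dist ((N i).root 0) (v i) ≤ r) →
      ∃ c : W, ∀ᶠ i in U, x i c = v i := by
    intro v r hv
    obtain ⟨c, hc⟩ := hcode v r hv
    refine ⟨⟨c, hc.mono fun i hi => ⟨_, hi⟩⟩, hc.mono fun i hi => ?_⟩
    simp only [← hi, hx]
  have hWfin : ∀ r, {c : W | c.1.1 ≤ r}.Finite := by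
    intro r
    refine ((finite_codes b r).preimage Subtype.val_injective.injOn).subset fun c hc => ⟨hc, ?_⟩
    obtain ⟨i, hi⟩ := (hW c).exists
    have := (hed i (x i c)).2
    rwa [hi] at this
  let G : SimpleGraph W :=
    { Adj := fun c c' => ∀ᶠ i in U, (N i).graph.Adj (x i c) (x i c')
      symm := ⟨fun c c' h => h.mono fun i hi => hi.symm⟩
      loopless := ⟨fun c h => by
        obtain ⟨i, hi⟩ := h.exists
        exact (N i).graph.loopless.irrefl _ hi⟩ }
  obtain ⟨o, ho⟩ := hexists (fun i => (N i).root 0) 0 (Eventually.of_forall fun i => by simp)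
  have hwalk : ∀ {c c' : W} (p : G.Walk c c'),
      ∀ᶠ i in U, (N i).graph.dist (x i c) (x i c') ≤ p.length := by
    intro c c' p
    induction p with
    | nil => simp
    | @cons c₁ c₂ c₃ h p ih =>
      have h' : ∀ᶠ i in U, (N i).graph.Adj (x i c₁) (x i c₂) := h
      filter_upwards [ih, h'] with i hi hi'
      have h1 := (N i).connected.dist_triangle (u := x i c₁) (v := x i c₂) (w := x i c₃)
      have h2 := dist_le_one_of_adj hi'
      rw [SimpleGraph.Walk.length_cons]
      omega
  -- A vertex at distance `d + 1` has, for almost every `i`, a neighbour at distance `d`; the label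
  -- of the chosen neighbour stabilizes and continues the walk in the limit.
  have hreach : ∀ (d : ℕ) (c : W), c.1.1 = d → ∃ p : G.Walk o c, p.length ≤ d := by
    intro d
    induction d with
    | zero =>
      intro c hc
      have : o = c := by
        obtain ⟨i, h1, h2, h3, h4⟩ := (ho.and ((hWd c).and ((hW c).and (hW o)))).exists
        rw [hc, (N i).connected.dist_eq_zero_iff] at h2
        exact Subtype.ext (by rw [← h4, ← h3, h1, h2])
      subst this
      exact ⟨.nil, le_rfl⟩
    | succ d ih =>
      intro c hc
      have hnb : ∀ᶠ i in U, ∃ w, (N i).graph.Adj (x i c) w ∧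
          (N i).graph.dist ((N i).root 0) w = d := by
        filter_upwards [hWd c] with i hi
        rw [hc] at hi
        rcases exists_adj_of_dist_le_succ (N i).connected hi.le with h | ⟨w, hw, hwd⟩
        · simp [h] at hi
        · refine ⟨w, hw, ?_⟩
          have h1 := (N i).connected.dist_triangle (u := (N i).root 0) (v := w) (w := x i c)
          have h2 := dist_le_one_of_adj hw.symm
          omega
      let v : ∀ i, (N i).V := fun i =>
        if h : ∃ w, (N i).graph.Adj (x i c) w ∧ (N i).graph.dist ((N i).root 0) w = d
        then h.choose else (N i).root 0
      have hv : ∀ᶠ i in U, (N i).graph.Adj (x i c) (v i) ∧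
          (N i).graph.dist ((N i).root 0) (v i) = d := by
        filter_upwards [hnb] with i hi
        simp only [v, dif_pos hi]
        exact hi.choose_spec
      obtain ⟨c', hc'⟩ := hexists v d (hv.mono fun i hi => hi.2.le)
      have hadj : G.Adj c' c := by
        change ∀ᶠ i in U, (N i).graph.Adj (x i c') (x i c)
        filter_upwards [hv, hc'] with i hi hi'
        rw [hi']
        exact hi.1.symm
      have hd : c'.1.1 = d := by
        obtain ⟨i, h1, h2, h3⟩ := (hv.and (hc'.and (hWd c'))).exists
        rw [← h3, h2, h1.2]
      obtain ⟨p, hp⟩ := ih c' hd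
      refine ⟨p.concat hadj, ?_⟩
      rw [SimpleGraph.Walk.length_concat]
      omega
  have hconn : G.Connected := by
    rw [SimpleGraph.connected_iff_exists_forall_reachable]
    exact ⟨o, fun c => (hreach _ c rfl).choose.reachable⟩
  have hdist : ∀ c : W, G.dist o c = c.1.1 := by
    intro c
    obtain ⟨p, hp⟩ := hreach _ c rfl
    refine le_antisymm ((SimpleGraph.dist_le p).trans hp) ?_
    obtain ⟨q, hq⟩ := hconn.exists_walk_length_eq_dist o c
    obtain ⟨i, h1, h2, h3⟩ := ((hwalk q).and (ho.and (hWd c))).exists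
    rw [← hq, ← h3, ← h2]
    exact h1
  have hmark : ∀ c : W, ∃ m ∈ C c.1.1, Tendsto (fun i => (N i).mark (x i c)) U (𝓝 m) := by
    intro c
    refine (hC c.1.1).ultrafilter_le_nhds' (U.map fun i => (N i).mark (x i c)) ?_
    exact (hWd c).mono fun i hi => (hN i _).2 _ hi.le
  choose m hmC hm using hmark
  let L : Network Ξ 1 := ⟨W, G, hconn, fun c => by
    refine (hWfin (c.1.1 + 1)).subset fun c' hc' => ?_
    have h1 := hconn.dist_triangle (u := o) (v := c) (w := c')
    have h2 := dist_le_one_of_adj (G := G) hc'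
    rw [hdist, hdist] at h1
    change c'.1.1 ≤ c.1.1 + 1
    omega, m, fun _ => o⟩
  have hball : ∀ (n : ℕ) (c : W), c ∈ L.ball n ↔ c.1.1 ≤ n := by
    intro n c
    rw [← hdist c]
    exact mem_ball_one (N := L)
  have hloc : ∀ n : ℕ, 0 < n → ∀ᶠ i in U, LocalIso n (1 / n) L (N i) fun c : W => x i c := by
    intro n hn
    have hn' : (0 : ℝ) < 1 / n := by positivity
    have h1 : ∀ᶠ i in U, ∀ c ∈ {c : W | c.1.1 ≤ n}, e i (x i c) = c ∧
        (N i).graph.dist ((N i).root 0) (x i c) = c.1.1 ∧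
        dist ((N i).mark (x i c)) (m c) < 1 / n :=
      (eventually_all_finite (hWfin n)).2 fun c _ =>
        (hW c).and ((hWd c).and (Metric.tendsto_nhds.1 (hm c) _ hn'))
    have h2 : ∀ᶠ i in U, ∀ c ∈ {c : W | c.1.1 ≤ n}, ∀ c' ∈ {c : W | c.1.1 ≤ n},
        ((N i).graph.Adj (x i c) (x i c') ↔ G.Adj c c') := by
      refine (eventually_all_finite (hWfin n)).2 fun c _ =>
        (eventually_all_finite (hWfin n)).2 fun c' _ => ?_
      by_cases h : G.Adj c c'
      · have h' : ∀ᶠ i in U, (N i).graph.Adj (x i c) (x i c') := h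
        filter_upwards [h'] with i hi
        exact iff_of_true hi h
      · filter_upwards [Ultrafilter.eventually_not.2 h] with i hi
        exact iff_of_false hi h
    have h3 : ∀ᶠ i in U, ∀ v, (N i).graph.dist ((N i).root 0) v ≤ n →
        ∃ c ∈ {c : W | c.1.1 ≤ n}, x i c = v := by
      -- For an ultrafilter, failure means that almost every `N i` has a vertex in the `n`-ball that
      -- is missed. A choice of such vertices would contradict `hexists`.
      by_contra hcon
      have hcon' := Ultrafilter.eventually_not.2 hcon
      let v : ∀ i, (N i).V := fun i =>
        if h : ∃ v, (N i).graph.dist ((N i).root 0) v ≤ n ∧ ∀ c ∈ {c : W | c.1.1 ≤ n}, x i c ≠ v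
        then h.choose else (N i).root 0
      have hv : ∀ᶠ i in U, (N i).graph.dist ((N i).root 0) (v i) ≤ n ∧
          ∀ c ∈ {c : W | c.1.1 ≤ n}, x i c ≠ v i := by
        filter_upwards [hcon'] with i hi
        have hi' : ∃ v, (N i).graph.dist ((N i).root 0) v ≤ n ∧
            ∀ c ∈ {c : W | c.1.1 ≤ n}, x i c ≠ v := by
          push Not at hi
          exact hi
        simp only [v, dif_pos hi']
        exact hi'.choose_spec
      obtain ⟨c, hc⟩ := hexists v n (hv.mono fun i hi => hi.1)
      obtain ⟨i, h4, h5, h6⟩ := (hv.and (hc.and (hWd c))).exists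
      refine h4.2 c ?_ h5
      change c.1.1 ≤ n
      rw [← h6, h5]
      exact h4.1
    filter_upwards [h1, h2, h3, ho] with i h1 h2 h3 ho
    refine ⟨⟨fun c hc => ?_, fun c hc c' hc' hcc => ?_, fun v hv => ?_⟩,
      fun c hc c' hc' => h2 c ((hball n c).1 hc) c' ((hball n c').1 hc'), fun j => ?_,
      fun c hc => (h1 c ((hball n c).1 hc)).2.2.le⟩
    · rw [hball] at hc
      exact mem_ball_one.2 ((h1 c hc).2.1.trans_le hc)
    · rw [hball] at hc hc'
      have hcc' : x i c = x i c' := hcc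
      exact Subtype.ext (by rw [← (h1 c hc).1, ← (h1 c' hc').1, hcc'])
    · obtain ⟨c, hc, hcv⟩   := h3 v (mem_ball_one.1 hv)
      exact ⟨c, (hball n c).2 hc, hcv⟩
    · rw [Subsingleton.elim j 0]
      exact ho
  refine ⟨L, fun r => ⟨?_, fun c hc => ?_⟩, ?_⟩
  · obtain ⟨i, hi⟩ := (hloc (r + 1) r.succ_pos).exists
    have hb := (hi.mono r.le_succ le_rfl).bijOn
    have e1 : {v | L.graph.dist (L.root 0) v ≤ r} = L.ball r := by
      ext v; exact mem_ball_one.symm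
    have e2 : {v | (N i).graph.dist ((N i).root 0) v ≤ r} = (N i).ball r := by
      ext v; exact mem_ball_one.symm
    have := (hN i r).1
    rw [e2, ← hb.image_eq, hb.injOn.ncard_image, ← e1] at this
    exact this
  · exact hCmono ((hdist c).symm.trans_le hc) (hmC c)
  · intro s hs
    obtain ⟨n, hn, hns⟩ := NetworkClass.eventually_nhds_mk.1 hs
    exact (hloc n hn).mono fun i hi => hns _ (agree_natCast_iff.2 ⟨_, hi⟩)

end Network

namespace NetworkClass

open Network

theorem isCompact_image_boundedBalls {Ξ : Type} [PseudoMetricSpace Ξ] {C : ℕ → Set Ξ}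
    (hC : ∀ r, IsCompact (C r)) (hCmono : Monotone C) (b : ℕ → ℕ) :
    IsCompact (mk '' boundedBalls b C) := by
  classical
  refine isCompact_iff_ultrafilter_le_nhds'.2 fun U hU => ?_
  obtain ⟨_, N₀, hN₀, rfl⟩ := U.neBot.nonempty_of_mem hU
  let N : NetworkClass Ξ 1 → Network Ξ 1 := fun g =>
    if h : g ∈ mk '' boundedBalls b C then h.choose else N₀
  have hN : ∀ g, N g ∈ boundedBalls b C := fun g => by
    by_cases h : g ∈ mk '' boundedBalls b C
    · simp only [N, dif_pos h]
      exact h.choose_spec.1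
    · simpa only [N, dif_neg h]
  have hmk : ∀ᶠ g in U, mk (N g) = g := by
    filter_upwards [hU] with g h
    simp only [N, dif_pos h]
    exact h.choose_spec.2
  obtain ⟨L, hL, hlim⟩ := exists_tendsto_ultrafilter U hC hCmono N hN
  exact ⟨_, ⟨L, hL, rfl⟩, (tendsto_congr' hmk).1 hlim⟩

end NetworkClass

/-! ### Tightness of conformal metrics -/

open Network NetworkClass

/-- The laws of `f` on ℕ together with their limit form a compact set, so they are tight by the
converse of Prokhorov's theorem, and compact subsets of ℕ are bounded. -/
theorem exists_forall_measure_lt_le {X : Type*} [TopologicalSpace X] [MeasurableSpace X]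
    [OpensMeasurableSpace X] {P : ℕ → ProbabilityMeasure X} {P' : ProbabilityMeasure X}
    (hlim : Tendsto P atTop (𝓝 P')) {f : X → ℕ} (hf : Continuous f) {ε : ℝ≥0∞} (hε : 0 < ε) :
    ∃ k, ∀ n, (P n : Measure X) {x | k < f x} ≤ ε := by
  have hlim' := ProbabilityMeasure.tendsto_map_of_tendsto_of_continuous P P' hlim hf
  have hc := hlim'.isCompact_insert_range
  have hsub : closure (Set.range fun n => (P n).map hf.measurable.aemeasurable) ⊆
      insert (P'.map hf.measurable.aemeasurable)
        (Set.range fun n => (P n).map hf.measurable.aemeasurable) :=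
    closure_minimal (Set.subset_insert _ _) hc.isClosed
  have ht := isTightMeasureSet_of_isCompact_closure (hc.of_isClosed_subset isClosed_closure hsub)
  obtain ⟨K, hK, hKε⟩ := isTightMeasureSet_iff_exists_isCompact_measure_compl_le.1 ht ε hε
  obtain ⟨k, hk⟩ := (isCompact_iff_finite.1 hK).bddAbove
  refine ⟨k, fun n => ?_⟩
  have h1 := hKε _ ⟨_, ⟨n, rfl⟩, rfl⟩
  rw [ProbabilityMeasure.toMeasure_map,
    Measure.map_apply hf.measurable hK.isClosed.measurableSet.compl] at h1
  refine (measure_mono fun x hx => ?_).trans h1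
  intro hxK
  exact (hk hxK).not_gt hx

/-- Doubly rooted conformal graphs whose roots have distance at most `r`, whose `r`-balls around the
roots have at most `k` vertices, and in which the second root has weight more than `b`. -/
def heavySet (r k : ℕ) (b : ℝ≥0) : Set (NetworkClass ℝ≥0 2) :=
  {g | rootDist 0 1 g ≤ r ∧ ballSize 0 r g ≤ k ∧ ballSize 1 r g ≤ k ∧ b < rootMark 1 g}

theorem measurableSet_heavySet (r k : ℕ) (b : ℝ≥0) : MeasurableSet (heavySet r k b) := by
  have h1 := ((isOpen_discrete (Set.Iic r)).preimage
    (continuous_rootDist (Ξ := ℝ≥0) (k := 2) 0 1)).measurableSet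
  have h2 := fun i => ((isOpen_discrete (Set.Iic k)).preimage
    (continuous_ballSize (Ξ := ℝ≥0) (k := 2) i r)).measurableSet
  have h3 := (isOpen_Ioi (a := b)).preimage (continuous_rootMark (Ξ := ℝ≥0) (k := 2) 1)
  exact h1.inter ((h2 0).inter ((h2 1).inter h3.measurableSet))

/-- After the swap the root is the heavy vertex: it receives nothing unless its weight exceeds `b`,
and then only from its own `r`-ball, which must have at most `k` vertices. -/
theorem massOut_heavySet_swap_le (r k : ℕ) (b : ℝ≥0) (g : RootedConformalGraph) :
    massOut ((heavySet r k b).indicator 1 ∘ swap) g ≤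
      {g : RootedConformalGraph | b < rootMark 0 g}.indicator (fun _ => (k : ℝ≥0∞)) g := by
  by_cases h : b < rootMark 0 g ∧ ballSize 0 r g ≤ k
  · rw [Set.indicator_of_mem (s := {g : RootedConformalGraph | b < rootMark 0 g}) h.1]
    refine (massOut_le_ballSize_mul (r := r) (c := 1) (fun x hx => ?_) (fun x => ?_) g).trans ?_
    · refine Set.indicator_of_notMem (fun hx' => ?_) _
      have := hx'.1
      rw [rootDist_swap] at this
      omega
    · exact Set.indicator_le_self' (fun _ _ => zero_le) _
    · rw [mul_one]
      exact_mod_cast h.2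
  · obtain ⟨N, rfl⟩ := mk_surjective g
    rw [massOut_mk, ENNReal.tsum_eq_zero.2]
    · exact zero_le
    · exact fun x => Set.indicator_of_notMem (fun hx => h ⟨hx.2.2.2, hx.2.2.1⟩) _

/-- Radius `2 * r` is used because it also bounds the `r`-ball around the heavy vertex. -/
theorem one_le_massOut_heavySet {r k : ℕ} {b : ℝ≥0} {N : Network ℝ≥0 1}
    (hk : {v | N.graph.dist (N.root 0) v ≤ 2 * r}.ncard ≤ k) {v : N.V}
    (hv : N.graph.dist (N.root 0) v ≤ r) (hb : b < N.mark v) :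
    1 ≤ massOut ((heavySet r k b).indicator 1) (mk N) := by
  have hfin := N.finite_closedBall (N.root 0) (2 * r)
  have hmem : mk (N.reroot ![N.root 0, v]) ∈ heavySet r k b := by
    refine ⟨hv, ?_, ?_, hb⟩
    · refine (Set.ncard_le_ncard (fun w hw => ?_) hfin).trans hk
      have hw' : N.graph.dist (N.root 0) w ≤ r := hw
      exact Set.mem_ofPred.2 (by omega)
    · refine (Set.ncard_le_ncard (fun w hw => ?_) hfin).trans hk
      have hw' : N.graph.dist v w ≤ r := hw
      have := N.connected.dist_triangle (u := N.root 0) (v := v) (w := w)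
      exact Set.mem_ofPred.2 (by omega)
  rw [massOut_mk]
  refine le_trans ?_ (ENNReal.le_tsum v)
  rw [Set.indicator_of_mem hmem]
  rfl

/-- Markov's inequality; $b\le b^q$ makes a bound linear in $1/b$ available for every $q\ge1$. -/
theorem mul_measure_rootMark_gt_le {q : ℝ} (hq : 1 ≤ q) {Q : ProbabilityMeasure RootedConformalGraph}
    (hQ : ∫⁻ g, (RootedConformalGraph.rootWeight g : ℝ≥0∞) ^ q
      ∂(Q : Measure RootedConformalGraph) ≤ 1) {b : ℝ≥0} (hb : 1 ≤ b) :
    (b : ℝ≥0∞) * (Q : Measure RootedConformalGraph) {g | b < rootMark 0 g} ≤ 1 := by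
  have hm : Measurable fun g : RootedConformalGraph =>
      (RootedConformalGraph.rootWeight g : ℝ≥0∞) ^ q :=
    ((continuous_rootMark (Ξ := ℝ≥0) (k := 1) 0).measurable.coe_nnreal_ennreal).pow_const q
  refine le_trans ?_ ((mul_meas_ge_le_lintegral hm b).trans hQ)
  gcongr with g
  intro hg
  have hb' : (1 : ℝ≥0∞) ≤ b := by exact_mod_cast hb
  have hg' : (b : ℝ≥0∞) ≤ RootedConformalGraph.rootWeight g := by exact_mod_cast hg.le
  calc (b : ℝ≥0∞) = (b : ℝ≥0∞) ^ (1 : ℝ) := (ENNReal.rpow_one _).symm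
    _ ≤ (b : ℝ≥0∞) ^ q := ENNReal.rpow_le_rpow_of_exponent_le hb' hq
    _ ≤ _ := ENNReal.rpow_le_rpow hg' (by linarith)

theorem RootedConformalGraph.continuous_toRootedGraph :
    Continuous RootedConformalGraph.toRootedGraph :=
  continuous_mapMark (f := fun _ : ℝ≥0 => ()) (LipschitzWith.const' ())

theorem RootedConformalGraph.continuous_rootWeight :
    Continuous RootedConformalGraph.rootWeight :=
  continuous_rootMark (Ξ := ℝ≥0) (k := 1) 0

theorem RootedConformalGraph.continuous_rootWeight_rpow (q : ℝ) :
    Continuous fun g => (RootedConformalGraph.rootWeight g : ℝ≥0∞) ^ q :=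
  ENNReal.continuous_rpow_const.comp
    (ENNReal.continuous_coe.comp RootedConformalGraph.continuous_rootWeight)

section

variable {q : ℝ} {P : ℕ → ProbabilityMeasure RootedGraph} {P' : ProbabilityMeasure RootedGraph}
  {Q : ℕ → ProbabilityMeasure RootedConformalGraph}

/-- The exceptional event is that the `2r`-ball is large or that the root sends mass to a heavy
vertex. The first has probability at most $\varepsilon/2$ by convergence of the graphs, the second
by mass transport once $b\ge k/(\varepsilon/2)$. -/
theorem exists_forall_measure_unbounded_le (hq : 1 ≤ q) (hlim : Tendsto P atTop (𝓝 P'))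
    (hQ : ∀ n, IsConformalMetricOn (Q n) (P n))
    (hint : ∀ n, ∫⁻ g, (RootedConformalGraph.rootWeight g : ℝ≥0∞) ^ q
      ∂(Q n : Measure RootedConformalGraph) ≤ 1) (r : ℕ) {ε : ℝ≥0∞} (hε : 0 < ε) :
    ∃ (b : ℕ) (S : Set RootedConformalGraph),
      (∀ n, (Q n : Measure RootedConformalGraph) S ≤ ε) ∧
      ∀ N : Network ℝ≥0 1, mk N ∉ S → {v | N.graph.dist (N.root 0) v ≤ r}.ncard ≤ b ∧
        ∀ v, N.graph.dist (N.root 0) v ≤ r → N.mark v ≤ b := by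
  obtain ⟨k, hk⟩ := exists_forall_measure_lt_le hlim (f := ballSize 0 (2 * r))
    (continuous_ballSize 0 (2 * r)) (ENNReal.half_pos hε.ne')
  obtain ⟨a, ha⟩ : ∃ a : ℕ, (k : ℝ≥0∞) / (ε / 2) < a :=
    ENNReal.exists_nat_gt (ENNReal.div_lt_top (by simp) (ENNReal.half_pos hε.ne').ne').ne
  obtain ⟨b, hab, hb⟩ : ∃ b : ℕ, a ≤ b ∧ 1 ≤ b := ⟨a + 1, by omega, by omega⟩
  have hkb : (k : ℝ≥0∞) ≤ b * (ε / 2) := by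
    have h2 : (k : ℝ≥0∞) / (ε / 2) ≤ b := ha.le.trans (by exact_mod_cast hab)
    rwa [ENNReal.div_le_iff_le_mul (Or.inl (ENNReal.half_pos hε.ne').ne')
      (Or.inr (by simp; omega))] at h2
  refine ⟨max k b, {g | k < ballSize 0 (2 * r) g} ∪
    {g | 1 ≤ massOut ((heavySet r k b).indicator 1) g}, fun n => ?_, fun N hN => ?_⟩
  · refine (measure_union_le _ _).trans ?_
    rw [← ENNReal.add_halves ε]
    refine add_le_add ?_ ?_
    · have h1 := hk n
      have hms : MeasurableSet {g : RootedGraph | k < ballSize 0 (2 * r) g} :=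
        ((isOpen_discrete (Set.Ioi k)).preimage (continuous_ballSize 0 (2 * r))).measurableSet
      rw [← (hQ n).2, Measure.map_apply
        RootedConformalGraph.continuous_toRootedGraph.measurable hms] at h1
      refine (measure_mono fun g hg => ?_).trans h1
      obtain ⟨N, rfl⟩ := mk_surjective g
      exact hg
    · have hF : Measurable ((heavySet r k b).indicator (1 : NetworkClass ℝ≥0 2 → ℝ≥0∞)) :=
        measurable_one.indicator (measurableSet_heavySet r k b)
      have h1 := mul_meas_ge_le_lintegral (μ := (Q n : Measure RootedConformalGraph))
        (measurable_massOut hF) 1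
      rw [one_mul, unimodular_iff.1 (hQ n).1 _ hF] at h1
      refine h1.trans ((lintegral_mono fun g => massOut_heavySet_swap_le r k b g).trans ?_)
      have hms : MeasurableSet {g : RootedConformalGraph | (b : ℝ≥0) < rootMark 0 g} :=
        ((isOpen_Ioi (a := (b : ℝ≥0))).preimage
          (continuous_rootMark (Ξ := ℝ≥0) (k := 1) 0)).measurableSet
      rw [lintegral_indicator_const hms]
      have h2 := mul_measure_rootMark_gt_le hq (hint n) (b := b) (by exact_mod_cast hb)
      calc _ ≤ (b * (ε / 2)) * (Q n : Measure RootedConformalGraph)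
              {g | (b : ℝ≥0) < rootMark 0 g} := by gcongr
        _ = (ε / 2) * ((b : ℝ≥0) * (Q n : Measure RootedConformalGraph)
              {g | (b : ℝ≥0) < rootMark 0 g}) := by
            rw [mul_comm (b : ℝ≥0∞), mul_assoc]; rfl
        _ ≤ (ε / 2) * 1 := by gcongr
        _ = ε / 2 := mul_one _
  · rw [Set.mem_union, not_or] at hN
    have h1 : ballSize 0 (2 * r) (mk N) ≤ k := not_lt.1 hN.1
    have h2 := (ballSize_mono 0 (show r ≤ 2 * r by omega) (mk N)).trans h1
    refine ⟨h2.trans (le_max_left _ _), fun v hv => ?_⟩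
    by_contra! hcon
    refine hN.2 (one_le_massOut_heavySet h1 hv (lt_of_le_of_lt ?_ hcon))
    exact_mod_cast le_max_right k b

theorem isTightMeasureSet_range_conformalMetric (hq : 1 ≤ q) (hlim : Tendsto P atTop (𝓝 P'))
    (hQ : ∀ n, IsConformalMetricOn (Q n) (P n))
    (hint : ∀ n, ∫⁻ g, (RootedConformalGraph.rootWeight g : ℝ≥0∞) ^ q
      ∂(Q n : Measure RootedConformalGraph) ≤ 1) :
    IsTightMeasureSet {((μ : ProbabilityMeasure RootedConformalGraph) :
      Measure RootedConformalGraph) | μ ∈ Set.range Q} := by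
  refine isTightMeasureSet_iff_exists_isCompact_measure_compl_le.2 fun ε hε => ?_
  obtain ⟨δ, hδ, hδε⟩ := ENNReal.exists_pos_sum_of_countable' hε.ne' ℕ
  choose b S hS hb using fun r => exists_forall_measure_unbounded_le hq hlim hQ hint r (hδ r)
  -- Running maxima, since the compactness criterion wants mark bounds that increase with the
  -- radius.
  let B : ℕ → ℕ := fun r => (Finset.range (r + 1)).sup b
  have hbB : ∀ r, b r ≤ B r := fun r => Finset.le_sup (Finset.self_mem_range_succ r)
  have hB : Monotone B := fun r s hrs =>
    Finset.sup_mono (Finset.range_mono (by omega))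
  refine ⟨mk '' boundedBalls B fun r => Set.Icc 0 (B r : ℝ≥0), isCompact_image_boundedBalls
    (fun r => isCompact_Icc) (fun r s hrs => Set.Icc_subset_Icc_right
      (by exact_mod_cast hB hrs)) B, ?_⟩
  rintro _ ⟨_, ⟨n, rfl⟩, rfl⟩
  refine (measure_mono (t := ⋃ r, S r) fun g hg => ?_).trans
    ((measure_iUnion_le _).trans ((ENNReal.tsum_le_tsum fun r => hS r n).trans hδε.le))
  by_contra hcon
  rw [Set.mem_iUnion, not_exists] at hcon
  obtain ⟨N, rfl⟩ := mk_surjective g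
  refine hg ⟨N, fun r => ⟨(hb r N (hcon r)).1.trans (hbB r), fun v hv => ⟨zero_le, ?_⟩⟩, rfl⟩
  exact ((hb r N (hcon r)).2 v hv).trans (by exact_mod_cast hbB r)

/-- Fatou's argument: the truncations of $\omega(\rho)^q$ at $m$ are bounded and continuous.
Equality may be lost, as the $q$-th powers need not be uniformly integrable. -/
theorem lintegral_rootWeight_rpow_le_of_tendsto {ι : Type*} {l : Filter ι} [l.NeBot]
    {Q : ι → ProbabilityMeasure RootedConformalGraph} {Q' : ProbabilityMeasure RootedConformalGraph}
    (h : Tendsto Q l (𝓝 Q'))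
    (hint : ∀ i, ∫⁻ g, (RootedConformalGraph.rootWeight g : ℝ≥0∞) ^ q
      ∂(Q i : Measure RootedConformalGraph) ≤ 1) :
    ∫⁻ g, (RootedConformalGraph.rootWeight g : ℝ≥0∞) ^ q
      ∂(Q' : Measure RootedConformalGraph) ≤ 1 := by
  have hc := RootedConformalGraph.continuous_rootWeight_rpow q
  have hc' : ∀ m : ℕ, Continuous fun g =>
      (RootedConformalGraph.rootWeight g : ℝ≥0∞) ^ q ⊓ (m : ℝ≥0∞) :=
    fun m => hc.inf continuous_const
  have e : ∀ g, (RootedConformalGraph.rootWeight g : ℝ≥0∞) ^ q =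
      ⨆ m : ℕ, (RootedConformalGraph.rootWeight g : ℝ≥0∞) ^ q ⊓ (m : ℝ≥0∞) := fun g => by
    rw [← inf_iSup_eq, ENNReal.iSup_natCast, inf_top_eq]
  rw [lintegral_congr e, lintegral_iSup (fun m => (hc' m).measurable) (fun m m' hm g => by
    dsimp only; gcongr)]
  refine iSup_le fun m => ?_
  refine le_of_tendsto (tendsto_lintegral_of_continuous_of_le h (hc' m) (c := m)
    fun g => by simp) (Eventually.of_forall fun i => ?_)
  exact (lintegral_mono fun g => inf_le_left).trans (hint i)

/-- Conformal metrics on a convergent sequence have a conformal metric on the limit as a limit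
along an ultrafilter. -/
theorem exists_tendsto_conformalMetric (hq : 1 ≤ q) (hlim : Tendsto P atTop (𝓝 P'))
    (hQ : ∀ n, IsConformalMetricOn (Q n) (P n))
    (hint : ∀ n, ∫⁻ g, (RootedConformalGraph.rootWeight g : ℝ≥0∞) ^ q
      ∂(Q n : Measure RootedConformalGraph) ≤ 1) :
    ∃ Q' : ProbabilityMeasure RootedConformalGraph, IsConformalMetricOn Q' P' ∧
      Tendsto Q (hyperfilter ℕ) (𝓝 Q') := by
  have hcomp := isCompact_closure_of_isTightMeasureSet
    (isTightMeasureSet_range_conformalMetric hq hlim hQ hint)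
  obtain ⟨Q', -, hQ'⟩ := hcomp.ultrafilter_le_nhds' ((hyperfilter ℕ).map Q)
    (Ultrafilter.mem_map.2 (Filter.mem_of_superset Filter.univ_mem
      fun n _ => subset_closure ⟨n, rfl⟩))
  have hQ'' : Tendsto Q (hyperfilter ℕ) (𝓝 Q') := hQ'
  refine ⟨Q', ⟨Unimodular.of_tendsto (fun n => (hQ n).1) hQ'', ?_⟩, hQ''⟩
  have h1 := ProbabilityMeasure.tendsto_map_of_tendsto_of_continuous Q Q' hQ''
    RootedConformalGraph.continuous_toRootedGraph
  have h2 : ∀ n, (Q n).map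
      RootedConformalGraph.continuous_toRootedGraph.measurable.aemeasurable = P n :=
    fun n => Subtype.ext (hQ n).2
  simp_rw [h2] at h1
  have h3 := tendsto_nhds_unique h1 (hlim.mono_left Nat.hyperfilter_le_atTop)
  exact congrArg (fun μ : ProbabilityMeasure RootedGraph => (μ : Measure RootedGraph)) h3

end

/-! ### Growth of balls under local isomorphisms and changes of the weights -/

open Network NetworkClass

theorem walkLength_cons {V : Type} {G : SimpleGraph V} (ω : V → ℝ≥0) {u v w : V} (h : G.Adj u v)
    (p : G.Walk v w) :
    walkLength ω (SimpleGraph.Walk.cons h p) = (ω u + ω v) / 2 + walkLength ω p := by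
  simp [walkLength]

theorem walkLength_le_mul {V : Type} {G : SimpleGraph V} {ω ω' : V → ℝ≥0} {c : ℝ≥0}
    (h : ∀ v, ω v ≤ c * ω' v) {u v : V} (p : G.Walk u v) :
    walkLength ω p ≤ c * walkLength ω' p := by
  induction p with
  | nil => simp [walkLength]
  | @cons u v w huv p ih =>
    rw [walkLength_cons, walkLength_cons, mul_add, ← mul_div_assoc, mul_add]
    gcongr
    · exact h u
    · exact h v

theorem confDist_le_mul {V : Type} {G : SimpleGraph V} (hG : G.Connected) {ω ω' : V → ℝ≥0}
    {c : ℝ≥0} (h : ∀ v, ω v ≤ c * ω' v) (u v : V) :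
    confDist G ω u v ≤ c * confDist G ω' u v := by
  have : Nonempty (G.Walk u v) := hG u v
  rw [confDist, confDist, NNReal.mul_iInf]
  exact le_ciInf fun p => (ciInf_le (OrderBot.bddBelow _) p).trans (walkLength_le_mul h p)

/-- Both endpoint weights of an edge grow by at most `ε`, hence so does their mean, the edge length.
-/
theorem Network.LocalIso.exists_walkLength_le {k n : ℕ} {ε : ℝ≥0} {N M : Network ℝ≥0 k}
    {f : N.V → M.V} (h : LocalIso n ε N M f) {u v : N.V} (p : N.graph.Walk u v) :
    ∀ a : ℕ, u ∈ N.ball a → a + p.length ≤ n → ∃ q : M.graph.Walk (f u) (f v),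
      walkLength M.mark q ≤ walkLength N.mark p + p.length * ε := by
  induction p with
  | nil => exact fun a _ _ => ⟨.nil, by simp [walkLength]⟩
  | @cons u v w huv p ih =>
    intro a hu ha
    rw [SimpleGraph.Walk.length_cons] at ha
    have hv : v ∈ N.ball (a + 1 : ℕ) := mem_ball_of_dist_le hu (dist_le_one_of_adj huv) le_rfl
    have hu' := ball_natCast_mono N (show a ≤ n by omega) hu
    have hv' := ball_natCast_mono N (show a + 1 ≤ n by omega) hv
    obtain ⟨q, hq⟩ := ih (a + 1) hv (by omega)
    refine ⟨.cons ((h.adj u hu' v hv').2 huv) q, ?_⟩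
    have hmark : ∀ x ∈ N.ball n, M.mark (f x) ≤ N.mark x + ε := fun x hx => by
      have := h.mark x hx
      rw [NNReal.dist_eq] at this
      rw [← NNReal.coe_le_coe, NNReal.coe_add]
      linarith [le_abs_self ((M.mark (f x) : ℝ) - N.mark x)]
    rw [walkLength_cons, walkLength_cons, SimpleGraph.Walk.length_cons]
    calc _ ≤ (N.mark u + ε + (N.mark v + ε)) / 2 +
          (walkLength N.mark p + p.length * ε) := by
          gcongr
          · exact hmark u hu'
          · exact hmark v hv'
      _ = _ := by
          rw [← NNReal.coe_inj]
          push_cast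
          ring

namespace RootedConformalGraph

/-- The ball may be infinite, but exceeding `c` is witnessed by a finite set, which a local
isomorphism can see. -/
theorem lt_ballCard_iff {c : ℝ≥0∞} {R : ℝ≥0} {N : Network ℝ≥0 1} :
    c < ((ballCard R (mk N) : ℕ∞) : ℝ≥0∞) ↔ ∃ T : Set N.V, T.Finite ∧
      T ⊆ confBall N.graph N.mark (N.root 0) R ∧ c < ((T.encard : ℕ∞) : ℝ≥0∞) := by
  constructor
  · intro h
    obtain ⟨m, hcm, hm⟩ : ∃ m : ℕ, c < m ∧
        (m : ℕ∞) ≤ (confBall N.graph N.mark (N.root 0) R).encard := by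
      change c < (((confBall N.graph N.mark (N.root 0) R).encard : ℕ∞) : ℝ≥0∞) at h
      cases hx : (confBall N.graph N.mark (N.root 0) R).encard with
      | top =>
        rw [hx] at h
        obtain ⟨m, hm⟩ := ENNReal.exists_nat_gt (ne_top_of_lt h)
        exact ⟨m, hm, le_top⟩
      | coe m =>
        rw [hx] at h
        exact ⟨m, by simpa using h, le_rfl⟩
    obtain ⟨T, hT, hTm⟩ := Set.exists_subset_encard_eq hm
    exact ⟨T, Set.finite_of_encard_eq_coe hTm, hT, by simpa [hTm] using hcm⟩
  · rintro ⟨T, -, hT, hc⟩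
    exact hc.trans_le (by exact_mod_cast Set.encard_le_encard hT)

/-- Ball sizes are lower semicontinuous, up to an enlargement of the radius. -/
theorem eventually_lt_ballCard {c : ℝ≥0∞} {R R' : ℝ≥0} (hR : R < R') {g : RootedConformalGraph}
    (hg : c < ((ballCard R g : ℕ∞) : ℝ≥0∞)) :
    ∀ᶠ g' in 𝓝 g, c < ((ballCard R' g' : ℕ∞) : ℝ≥0∞) := by
  obtain ⟨N, rfl⟩ := mk_surjective g
  obtain ⟨T, hTfin, hT, hc⟩ := lt_ballCard_iff.1 hg
  -- The distance is an infimum that need not be attained; the gap between `R` and `R'` supplies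
  -- actual walks, and later absorbs the error `length / n` from the marks.
  have hwalk : ∀ y : T, ∃ p : N.graph.Walk (N.root 0) y, walkLength N.mark p < R' := by
    intro y
    have : Nonempty (N.graph.Walk (N.root 0) y) := N.connected _ _
    exact exists_lt_of_ciInf_lt (lt_of_le_of_lt (hT y.2) hR)
  choose p hp using hwalk
  have : Finite T := hTfin
  have hev : ∀ᶠ n : ℕ in atTop, ∀ y : T, (p y).length ≤ n ∧
      walkLength N.mark (p y) + (p y).length * (1 / (n : ℝ≥0)) < R' := by
    refine eventually_all.2 fun y => (eventually_ge_atTop _).and ?_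
    have h1 : Tendsto (fun n : ℕ => walkLength N.mark (p y) +
        (p y).length * (1 / (n : ℝ≥0))) atTop (𝓝 (walkLength N.mark (p y) +
        (p y).length * 0)) :=
      tendsto_const_nhds.add (tendsto_const_nhds.mul tendsto_one_div_atTop_nhds_zero_nat)
    rw [mul_zero, add_zero] at h1
    exact h1.eventually_lt_const (hp y)
  obtain ⟨m, hm⟩ := eventually_atTop.1 hev
  refine eventually_nhds_mk_of_localIso (m := m) fun n hmn hn M f hf => ?_
  have hf' : LocalIso n ((1 / n : ℝ≥0) : ℝ) N M f := by simpa using hf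
  refine lt_ballCard_iff.2 ⟨f '' T, hTfin.image f, ?_, ?_⟩
  · rintro _ ⟨y, hy, rfl⟩
    obtain ⟨h1, h2⟩ := hm n hmn ⟨y, hy⟩
    obtain ⟨q, hq⟩ := hf'.exists_walkLength_le (p ⟨y, hy⟩) 0 (root_mem_ball_natCast N 0 0)
      (by omega)
    change confDist M.graph M.mark (M.root 0) (f y) ≤ R'
    rw [← hf.root 0]
    exact (ciInf_le (OrderBot.bddBelow _) q).trans (hq.trans h2.le)
  · rw [Set.InjOn.encard_image]
    · exact hc
    · refine hf.bijOn.injOn.mono fun y hy => mem_ball_one.2 ?_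
      exact (SimpleGraph.dist_le (p ⟨y, hy⟩)).trans (hm n hmn ⟨y, hy⟩).1

theorem ballCard_le_ballCard_mapMark {f : ℝ≥0 → ℝ≥0} {c : ℝ≥0} (hf : ∀ x, x ≤ c * f x) (R : ℝ≥0)
    (g : RootedConformalGraph) : ballCard R (mapMark f g) ≤ ballCard (c * R) g := by
  obtain ⟨N, rfl⟩ := mk_surjective g
  refine Set.encard_le_encard fun y hy => ?_
  exact (confDist_le_mul N.connected (fun v => hf (N.mark v)) _ _).trans
    (mul_le_mul_right hy c)

end RootedConformalGraph

/-! ### Essential bounds on ball sizes under limits and changes of weights. -/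

open RootedConformalGraph

theorem measure_lt_ballCard_eq_zero {Q : ProbabilityMeasure RootedConformalGraph} {R : ℝ≥0}
    {c : ℝ≥0∞} (h : growth Q R ≤ c) :
    (Q : Measure RootedConformalGraph) {g | c < ((RootedConformalGraph.ballCard R g : ℕ∞) : ℝ≥0∞)} = 0 := by
  have h1 := ENNReal.ae_le_essSup (μ := (Q : Measure RootedConformalGraph))
    (fun g => ((RootedConformalGraph.ballCard R g : ℕ∞) : ℝ≥0∞))
  have h2 : ∀ᵐ g ∂(Q : Measure RootedConformalGraph), ¬ c < ((RootedConformalGraph.ballCard R g : ℕ∞) : ℝ≥0∞) := by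
    filter_upwards [h1] with g hg using not_lt.2 (hg.trans h)
  simpa [ae_iff] using h2

/-- The superlevel set at radius `R` lies in the interior of the one at `R'`. Working with that open
set avoids any measurability question about ball counts. -/
theorem growth_le_of_measure_eq_zero {Q : ProbabilityMeasure RootedConformalGraph} {R R' : ℝ≥0}
    (hR : R < R') {c : ℝ≥0∞} (h : (Q : Measure RootedConformalGraph)
      (interior {g | c < ((RootedConformalGraph.ballCard R' g : ℕ∞) : ℝ≥0∞)}) = 0) : growth Q R ≤ c := by
  refine essSup_le_of_ae_le c ?_
  have : (Q : Measure RootedConformalGraph) {g | c < ((RootedConformalGraph.ballCard R g : ℕ∞) : ℝ≥0∞)} = 0 :=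
    measure_mono_null (fun g hg => mem_interior_iff_mem_nhds.2 (eventually_lt_ballCard hR hg)) h
  rw [← compl_compl {g | c < ((RootedConformalGraph.ballCard R g : ℕ∞) : ℝ≥0∞)}] at this
  filter_upwards [mem_ae_iff.2 this] with g hg using not_lt.1 hg

/-- The portmanteau inequality on the open set above: it is null for every `Q i`, hence for the
limit. -/
theorem growth_le_of_tendsto {ι : Type*} {l : Filter ι} [l.NeBot]
    {Q : ι → ProbabilityMeasure RootedConformalGraph} {Q' : ProbabilityMeasure RootedConformalGraph}
    (hlim : Tendsto Q l (𝓝 Q')) {R R' : ℝ≥0} (hR : R < R') {c : ℝ≥0∞}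
    (h : ∀ i, growth (Q i) R' ≤ c) : growth Q' R ≤ c := by
  refine growth_le_of_measure_eq_zero hR (le_antisymm ?_ zero_le)
  refine (ProbabilityMeasure.le_liminf_measure_open_of_tendsto hlim isOpen_interior).trans ?_
  simp_rw [fun i => measure_mono_null interior_subset (measure_lt_ballCard_eq_zero (h i))]
  simp

theorem growth_map_mapMark_le {Q : ProbabilityMeasure RootedConformalGraph} {f : ℝ≥0 → ℝ≥0}
    (hf : LipschitzWith 1 f) {a : ℝ≥0} (hfa : ∀ x, x ≤ a * f x) {R R' : ℝ≥0} (hR : R < R')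
    {c : ℝ≥0∞} (h : growth Q (a * R') ≤ c) :
    growth (Q.map (continuous_mapMark hf).measurable.aemeasurable) R ≤ c := by
  refine growth_le_of_measure_eq_zero hR ?_
  rw [ProbabilityMeasure.toMeasure_map, Measure.map_apply (continuous_mapMark hf).measurable
    isOpen_interior.measurableSet]
  refine measure_mono_null (fun g hg => ?_) (measure_lt_ballCard_eq_zero h)
  have hg' : mapMark f g ∈ {g | c < ((RootedConformalGraph.ballCard R' g : ℕ∞) : ℝ≥0∞)} :=
    interior_subset hg
  have h1 : c < ((RootedConformalGraph.ballCard R' (mapMark f g) : ℕ∞) : ℝ≥0∞) := hg'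
  exact h1.trans_le (by exact_mod_cast ballCard_le_ballCard_mapMark hfa R' g)

theorem IsConformalMetricOn.map_mapMark {Q : ProbabilityMeasure RootedConformalGraph}
    {P : ProbabilityMeasure RootedGraph} (hQ : IsConformalMetricOn Q P) {f : ℝ≥0 → ℝ≥0}
    (hf : LipschitzWith 1 f) :
    IsConformalMetricOn (Q.map (continuous_mapMark hf).measurable.aemeasurable) P := by
  refine ⟨hQ.1.map_mapMark hf, ?_⟩
  rw [ProbabilityMeasure.toMeasure_map, Measure.map_map continuous_toRootedGraph.measurable
    (continuous_mapMark hf).measurable, ← hQ.2]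
  congr 1
  funext g
  obtain ⟨N, rfl⟩ := mk_surjective g
  rfl

/-! ### Normalization and conclusion. -/

theorem weightNorm_eq_one_iff {q : ℝ} (hq : 0 < q) {Q : ProbabilityMeasure RootedConformalGraph} :
    weightNorm q Q = 1 ↔
      ∫⁻ g, (rootWeight g : ℝ≥0∞) ^ q ∂(Q : Measure RootedConformalGraph) = 1 := by
  rw [weightNorm]
  constructor
  · intro h
    have := congrArg (fun x : ℝ≥0∞ => x ^ q) h
    simpa [← ENNReal.rpow_mul, one_div, inv_mul_cancel₀ hq.ne'] using this
  · intro h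
    rw [h, ENNReal.one_rpow]

/-- A conformal metric with `L^q`-norm at most one can be replaced by a normalized one, with
comparable growth. -/
theorem exists_normalized_conformalMetric {q : ℝ} (hq : 1 ≤ q)
    {P : ProbabilityMeasure RootedGraph} {Q : ProbabilityMeasure RootedConformalGraph}
    (hQ : IsConformalMetricOn Q P)
    (hint : ∫⁻ g, (rootWeight g : ℝ≥0∞) ^ q ∂(Q : Measure RootedConformalGraph) ≤ 1) :
    ∃ Q' : ProbabilityMeasure RootedConformalGraph, IsConformalMetricOn Q' P ∧
      IsNormalized q Q' ∧ ∀ (R R' : ℝ≥0) (c : ℝ≥0∞), R < R' → growth Q (2 * R') ≤ c →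
        growth Q' R ≤ c := by
  have hq0 : 0 < q := by linarith
  -- Dividing by the norm of `ω` is impossible if it vanishes. The floor at 1 gives $1\le
  -- I\le\mathbb{E}\,\omega^q+1\le2$.
  obtain ⟨I, hI⟩ : ∃ I, I = ∫⁻ g, ((max (rootWeight g) 1 : ℝ≥0) : ℝ≥0∞) ^ q
    ∂(Q : Measure RootedConformalGraph) := ⟨_, rfl⟩
  have hI1 : 1 ≤ I := by
    calc (1 : ℝ≥0∞) = ∫⁻ _, 1 ∂(Q : Measure RootedConformalGraph) := by simp
      _ ≤ I := by
        rw [hI]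
        refine lintegral_mono fun g => ENNReal.one_le_rpow ?_ hq0
        exact_mod_cast le_max_right _ _
  have hI2 : I ≤ 2 := by
    calc I ≤ ∫⁻ g, ((rootWeight g : ℝ≥0∞) ^ q + 1) ∂(Q : Measure RootedConformalGraph) := by
          rw [hI]
          refine lintegral_mono fun g => ?_
          rcases le_total (rootWeight g) 1 with h | h
          · rw [max_eq_right h, ENNReal.coe_one, ENNReal.one_rpow]
            exact le_add_self
          · rw [max_eq_left h]
            exact le_self_add
      _ = (∫⁻ g, (rootWeight g : ℝ≥0∞) ^ q ∂(Q : Measure RootedConformalGraph)) + 1 := by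
          rw [lintegral_add_right _ measurable_const]; simp
      _ ≤ 2 := by
          rw [← one_add_one_eq_two]; gcongr
  have hItop : I ≠ ∞ := (hI2.trans_lt (by simp)).ne
  obtain ⟨s, hs⟩ : ∃ s : ℝ≥0, s = I.toNNReal ^ (1 / q) := ⟨_, rfl⟩
  have hsI : (s : ℝ≥0∞) ^ q = I := by
    rw [hs, ← ENNReal.coe_rpow_of_nonneg _ hq0.le, ← NNReal.rpow_mul, one_div_mul_cancel hq0.ne',
      NNReal.rpow_one, ENNReal.coe_toNNReal hItop]
  have hIN1 : 1 ≤ I.toNNReal := by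
    rw [← ENNReal.coe_le_coe, ENNReal.coe_toNNReal hItop]; exact_mod_cast hI1
  have hIN2 : I.toNNReal ≤ 2 := by
    rw [← ENNReal.coe_le_coe, ENNReal.coe_toNNReal hItop]; exact_mod_cast hI2
  have hs1 : 1 ≤ s := hs ▸ NNReal.one_le_rpow hIN1 (by positivity)
  have hs2 : s ≤ 2 := by
    rw [hs]
    calc I.toNNReal ^ (1 / q) ≤ I.toNNReal ^ (1 : ℝ) :=
          NNReal.rpow_le_rpow_of_exponent_le hIN1 (by rw [div_le_one hq0]; exact hq)
      _ ≤ 2 := by rwa [NNReal.rpow_one]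
  have hs0 : 0 < s := by positivity
  -- $s=I^{1/q}\in[1,2]$: the bound $s\ge1$ keeps the change of marks 1-Lipschitz, and $s\le2$ makes
  -- the new weights at least half the old ones.
  have hf : LipschitzWith 1 fun x : ℝ≥0 => max x 1 / s := by
    refine LipschitzWith.of_dist_le_mul fun x y => ?_
    have h1 : |max (x : ℝ) 1 - max (y : ℝ) 1| ≤ |(x : ℝ) - y| :=
      abs_max_sub_max_le_abs _ _ _
    have h2 : (1 : ℝ) ≤ s := hs1
    rw [NNReal.dist_eq, NNReal.dist_eq, NNReal.coe_one, one_mul]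
    push_cast
    rw [← sub_div, abs_div, abs_of_pos (by linarith : (0 : ℝ) < s)]
    exact (div_le_self (abs_nonneg _) h2).trans h1
  have hf2 : ∀ x : ℝ≥0, x ≤ 2 * (max x 1 / s) := by
    intro x
    rw [← mul_div_assoc, le_div_iff₀ hs0, mul_comm x]
    exact mul_le_mul' hs2 (le_max_left _ _)
  refine ⟨_, hQ.map_mapMark hf, (weightNorm_eq_one_iff hq0).2 ?_,
    fun R R' c hR h => growth_map_mapMark_le hf hf2 hR h⟩
  rw [ProbabilityMeasure.toMeasure_map, lintegral_map
    (continuous_rootWeight_rpow q).measurable (continuous_mapMark hf).measurable]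
  have e : ∀ g : RootedConformalGraph, (rootWeight (mapMark (fun x => max x 1 / s) g) : ℝ≥0∞) ^ q =
      ((max (rootWeight g) 1 : ℝ≥0) : ℝ≥0∞) ^ q * I⁻¹ := by
    intro g
    have : rootWeight (mapMark (fun x => max x 1 / s) g) = max (rootWeight g) 1 / s := by
      obtain ⟨N, rfl⟩ := mk_surjective g
      rfl
    rw [this, ENNReal.coe_div hs0.ne', ENNReal.div_rpow_of_nonneg _ _ hq0.le, hsI, div_eq_mul_inv]
  rw [lintegral_congr e, lintegral_mul_const', ← hI, ENNReal.mul_inv_cancel]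
  · exact (zero_lt_one.trans_le hI1).ne'
  · exact hItop
  · exact ENNReal.inv_ne_top.2 (zero_lt_one.trans_le hI1).ne'

/-- Normalized conformal metrics on a convergent sequence yield a normalized conformal metric on the
limit which inherits uniform bounds on the growth. -/
theorem exists_conformalMetric_of_tendsto {q : ℝ} (hq : 1 ≤ q)
    {P : ℕ → ProbabilityMeasure RootedGraph} {P' : ProbabilityMeasure RootedGraph}
    (hlim : Tendsto P atTop (𝓝 P')) {Q : ℕ → ProbabilityMeasure RootedConformalGraph}
    (hQ : ∀ n, IsConformalMetricOn (Q n) (P n)) (hnorm : ∀ n, IsNormalized q (Q n)) :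
    ∃ Q' : ProbabilityMeasure RootedConformalGraph, IsConformalMetricOn Q' P' ∧
      IsNormalized q Q' ∧ ∀ (R : ℝ≥0) (c : ℝ≥0∞), 0 < R → (∀ n, growth (Q n) (8 * R) ≤ c) →
        growth Q' R ≤ c := by
  have hint := fun n => ((weightNorm_eq_one_iff (by linarith)).1 (hnorm n)).le
  obtain ⟨Q₁, hQ₁, hlim₁⟩ := exists_tendsto_conformalMetric hq hlim hQ hint
  obtain ⟨Q₂, hQ₂, hn₂, hg₂⟩ := exists_normalized_conformalMetric hq hQ₁
    (lintegral_rootWeight_rpow_le_of_tendsto hlim₁ hint)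
  -- Normalizing passes from $R$ to $2\cdot 2R=4R$, and the weak limit needs a strictly larger
  -- radius, here $8R$; strictness in both steps uses $R>0$.
  refine ⟨Q₂, hQ₂, hn₂, fun R c hR h => hg₂ R (2 * R) c ?_ (growth_le_of_tendsto hlim₁ ?_ h)⟩
  · rw [← NNReal.coe_lt_coe] at hR ⊢
    push_cast at hR ⊢
    linarith
  · rw [← NNReal.coe_lt_coe] at hR ⊢
    push_cast at hR ⊢
    linarith

theorem limsup_log_growth_le {d : ℝ} (hd : 0 ≤ d) {h : ℝ≥0 → ℝ≥0} (hh : IsSubpolynomial h)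
    {u : ℝ≥0 → ℝ≥0∞}
    (hu : ∀ R : ℝ≥0, 1 ≤ R → u R ≤ ((8 * R : ℝ≥0) : ℝ≥0∞) ^ d * (h (8 * R) : ℝ≥0∞)) :
    limsup (fun R : ℝ≥0 => ENNReal.log (u R) / ((Real.log (R : ℝ) : ℝ) : EReal)) atTop ≤ d := by
  obtain ⟨ε, hε, hhε⟩ := hh
  refine EReal.le_of_forall_lt_iff_le.1 fun x hx => ?_
  have hx' : d < x := by exact_mod_cast hx
  -- Half of the margin $x-d$ absorbs `h`, the other half the constant $8^{d+\delta}$.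
  obtain ⟨δ, hδ⟩ : ∃ δ, δ = (x - d) / 2 := ⟨_, rfl⟩
  have hδ0 : 0 < δ := by rw [hδ]; linarith
  have h8 : Tendsto (fun R : ℝ≥0 => 8 * R) atTop atTop :=
    tendsto_id.const_mul_atTop (by norm_num)
  have hpow : Tendsto (fun R : ℝ≥0 => R ^ δ) atTop atTop := NNReal.tendsto_rpow_atTop hδ0
  refine limsup_le_of_le (by isBoundedDefault) ?_
  filter_upwards [h8.eventually hhε, h8.eventually (hε.eventually_lt_const hδ0),
    hpow.eventually_ge_atTop (8 ^ (d + δ)), eventually_gt_atTop 1] with R h1 h2 h3 h4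
  have hlog : 0 < Real.log R := Real.log_pos (by exact_mod_cast h4)
  have hR8 : 1 ≤ 8 * R := h4.le.trans (le_mul_of_one_le_left zero_le (by norm_num))
  have hR0 : R ≠ 0 := (zero_lt_one.trans h4).ne'
  have hNN : (8 * R) ^ d * h (8 * R) ≤ R ^ x := by
    calc (8 * R) ^ d * h (8 * R) ≤ (8 * R) ^ d * (8 * R) ^ δ := by
          gcongr
          exact h1.trans (NNReal.rpow_le_rpow_of_exponent_le hR8 h2.le)
      _ = 8 ^ (d + δ) * R ^ (d + δ) := by
          rw [← NNReal.rpow_add (zero_lt_one.trans_le hR8).ne', NNReal.mul_rpow]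
      _ ≤ R ^ δ * R ^ (d + δ) := by gcongr
      _ = R ^ x := by
          rw [← NNReal.rpow_add hR0]
          congr 1
          rw [hδ]; ring
  have hu' : u R ≤ ((R ^ x : ℝ≥0) : ℝ≥0∞) := by
    refine (hu R h4.le).trans ?_
    rw [← ENNReal.coe_rpow_of_nonneg _ hd, ← ENNReal.coe_mul]
    exact_mod_cast hNN
  have hlogR : ENNReal.log ((R ^ x : ℝ≥0) : ℝ≥0∞) = ((x * Real.log R : ℝ) : EReal) := by
    have : ((R ^ x : ℝ≥0) : ℝ≥0∞) = ENNReal.ofReal ((R : ℝ) ^ x) := by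
      rw [← NNReal.coe_rpow, ENNReal.ofReal_coe_nnreal]
    have hRpos : (0 : ℝ) < R := by positivity
    rw [this, ENNReal.log_ofReal_of_pos (by positivity), Real.log_rpow hRpos]
  refine (EReal.div_le_iff_le_mul (by exact_mod_cast hlog) (EReal.coe_ne_top _)).2 ?_
  rw [← EReal.coe_mul, mul_comm, ← hlogR]
  exact ENNReal.log_monotone hu'

theorem mainTheorem9 (d q : ℝ) (hd : 1 ≤ d) (hq : 1 ≤ q)
    (P : ℕ → ProbabilityMeasure RootedGraph) (P' : ProbabilityMeasure RootedGraph)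
    (hP : ∀ n, Unimodular (P n)) (hlim : Tendsto P atTop (𝓝 P')) :
    (∀ (h : ℝ≥0 → ℝ≥0) (Q : ℕ → ProbabilityMeasure RootedConformalGraph),
      IsSubpolynomial h →
      (∀ n, IsConformalMetricOn (Q n) (P n)) →
      (∀ n, IsNormalized q (Q n)) →
      (∀ (n : ℕ) (R : ℝ≥0), 1 ≤ R → growth (Q n) R ≤ (R : ℝ≥0∞) ^ d * (h R : ℝ≥0∞)) →
      upperGrowthExponent q P' ≤ (d : EReal)) ∧
    (HasUniformGaugedGrowth d P → HasGaugedGrowth d P') := by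
  have h8 : ∀ R : ℝ≥0, 1 ≤ R → 1 ≤ 8 * R := fun R hR =>
    hR.trans (le_mul_of_one_le_left zero_le (by norm_num))
  refine ⟨fun h Q hh hQ hnorm hgrowth => ?_, ?_⟩
  · obtain ⟨Q', hQ', hn', hg'⟩ := exists_conformalMetric_of_tendsto hq hlim hQ hnorm
    refine iInf₂_le_of_le Q' ⟨hQ', hn'⟩ (limsup_log_growth_le (by linarith) hh fun R hR => ?_)
    exact hg' R _ (zero_lt_one.trans_le hR) fun n => hgrowth n (8 * R) (h8 R hR)
  · rintro ⟨C, hC, hgrowth⟩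
    refine ⟨C * 8 ^ d, ?_, fun R hR => ?_⟩
    · exact one_le_mul hC (NNReal.one_le_rpow (by norm_num) (by linarith))
    -- Gauged growth allows a different metric at each scale, so the limit is taken separately for
    -- each `R`, from metrics adapted to scale $8R$.
    · choose Q hQ hnorm hg using hgrowth (8 * R) (h8 R hR)
      obtain ⟨Q', hQ', hn', hg'⟩ := exists_conformalMetric_of_tendsto hd hlim hQ hnorm
      refine ⟨Q', hQ', hn', hg' R _ (zero_lt_one.trans_le hR) fun n => (hg n).trans (le_of_eq ?_)⟩
      have hd0 : 0 ≤ d := by linarith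
      rw [← ENNReal.coe_rpow_of_nonneg _ hd0, ← ENNReal.coe_rpow_of_nonneg _ hd0, ← ENNReal.coe_mul,
        ← ENNReal.coe_mul, NNReal.mul_rpow, mul_assoc]
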